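/- Let $R$ be a commutative ring, $M$ a finitely generated $R$-module and ${\bf x}=x_1,\dots,x_\ell$ a finite sequence of elements of $R$, with $\ell({\bf x})=\ell\ge 0$ its length. For $m\ge n$ put ${\bf x}^m=x_1^m,\dots,x_\ell^m$ and let $H_i({\bf x}^m,M)\to H_i({\bf x}^n,M)$ be the homomorphism of Koszul homology modules induced by the chain map $\mathbb K_\bullet({\bf x}^m,M)\to\mathbb K_\bullet({\bf x}^n,M)$ that is the tensor product over $j$ of the maps given by multiplication by $x_j^{m-n}$ in degree $1$ and the identity in degree $0$. The sequence ${\bf x}$ is called *$M$-weakly proregular* if for each $n$ there is $m\ge n$ such that $H_i({\bf x}^m,M)\to H_i({\bf x}^n,M)$ is zero for all $i\ge 1$. Let $H^i_{\bf x}(M)$ denote the $i$th cohomology of the Čech complex of $M$ with respect to ${\bf x}$. The sequence ${\bf x}$ is called a *parameter sequence on $M$* if (i) ${\bf x}$ is $M$-weakly proregular, (ii) ${\bf x}M\ne M$, and (iii) $H^{\ell}_{\bf x}(M)_{\mathfrak p}\neq 0$ for all primes $\mathfrak p\in\operatorname{Supp}_R(M/{\bf x}M)$. For a prime $\mathfrak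 p$ let $\operatorname{ht}_M\mathfrak p$ be the Krull dimension of the $R_{\mathfrak p}$-module $M_{\mathfrak p}$, and for an ideal $I$ let $\operatorname{ht}_M I=\inf\{\operatorname{ht}_M\mathfrak p : \mathfrak p\in\operatorname{Supp}M\cap V(I)\}$ (with $\inf\emptyset=\infty$). 1. If ${\bf x}$ is a parameter sequence on $M$, then $\operatorname{ht}_M({\bf x}R)\ge\ell({\bf x})$. 2. If moreover $R$ is Noetherian, then ${\bf x}$ is a parameter sequence on $M$ if and only if $\operatorname{ht}_M({\bf x}R)=\ell({\bf x})$. -/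

import Mathlib

/-!
Koszul homology, Čech cohomology, weakly proregular sequences, parameter sequences and the
height of an ideal on a module, for a finite sequence `x : Fin l → R` in a commutative ring `R`
and an `R`-module `M`.
-/

namespace ParamSeq

/-- The index set in degree `p` of the Koszul and Čech complexes of a sequence of length `l`:
the `p`-element subsets of the set of indices. -/
abbrev Idx (l p : ℕ) : Type := {s : Finset (Fin l) // s.card = p}

/-- The sign `(-1) ^ #{j ∈ s | j < i}`. -/
def sgn {l : ℕ} (s : Finset (Fin l)) (i : Fin l) : ℤ :=
  (-1) ^ (s.filter (fun j => j < i)).card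

theorem sgn_mul_sgn {l : ℕ} {t : Finset (Fin l)} {i j : Fin l} (hi : i ∈ t) (hj : j ∈ t)
    (hij : i ≠ j) :
    sgn t i * sgn (t.erase i) j + sgn t j * sgn (t.erase j) i = 0 := by
  have key : ∀ a b : Fin l, a ∈ t → b ∈ t → a < b →
      sgn t a * sgn (t.erase a) b + sgn t b * sgn (t.erase b) a = 0 := by
    intro a b ha hb hab
    have h1 : (t.erase b).filter (fun k => k < a) = t.filter (fun k => k < a) := by
      ext k
      simp only [Finset.mem_filter, Finset.mem_erase]
      constructor
      · rintro ⟨⟨-, h⟩, h'⟩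
        exact ⟨h, h'⟩
      · rintro ⟨h, h'⟩
        exact ⟨⟨(h'.trans hab).ne, h⟩, h'⟩
    have h2 : (t.erase a).filter (fun k => k < b) = (t.filter (fun k => k < b)).erase a := by
      ext k
      simp only [Finset.mem_filter, Finset.mem_erase]
      tauto
    have h3 : a ∈ t.filter (fun k => k < b) := by simp [ha, hab]
    have h4 := Finset.card_erase_add_one h3
    unfold sgn
    rw [h1, h2, ← h4, pow_succ]
    ring
  rcases lt_or_gt_of_ne hij with h | h
  · exact key i j hi hj h
  · rw [add_comm]
    exact key j i hj hi h

section Koszul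

variable {R : Type*} [CommRing R] {l : ℕ}

/-- The degree `p` term of the Koszul complex `K(x, M)` of a sequence of length `l`: the direct sum
of copies of `M`, one for each basis element `e_s = e_{i₁} ∧ ⋯ ∧ e_{i_p}` of the
`p`-th exterior power of `R ^ l`, where `s = {i₁ < ⋯ < i_p}`. -/
abbrev KoszulTerm (M : Type*) (l p : ℕ) : Type _ := Idx l p → M

/-- The Koszul differential `K_{p+1}(x, M) → K_p(x, M)`, that is
`e_t ⊗ m ↦ ∑ i ∈ t, ± e_{t \ i} ⊗ x_i m`: the coefficient of `d m` at `s` is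
`∑ i ∉ s, ± x_i m_{s ∪ {i}}`. -/
def koszulD (x : Fin l → R) (M : Type*) [AddCommGroup M] [Module R M] (p : ℕ) :
    KoszulTerm M l (p + 1) →ₗ[R] KoszulTerm M l p :=
  LinearMap.pi fun s => ∑ i : {i : Fin l // i ∉ s.1},
    ((sgn s.1 i.1 : R) * x i.1) • LinearMap.proj
      (⟨insert i.1 s.1, by rw [Finset.card_insert_of_notMem i.2, s.2]⟩ : Idx l (p + 1))

/-- The cycles of the Koszul complex in degree `p`. -/
def koszulCycles (x : Fin l → R) (M : Type*) [AddCommGroup M] [Module R M] :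
    (p : ℕ) → Submodule R (KoszulTerm M l p)
  | 0 => ⊤
  | p + 1 => LinearMap.ker (koszulD x M p)

/-- The Koszul homology `H_p(x, M)`, cycles modulo boundaries. -/
abbrev KoszulHomology (x : Fin l → R) (M : Type*) [AddCommGroup M] [Module R M] (p : ℕ) :
    Type _ :=
  koszulCycles x M p ⧸ (LinearMap.range (koszulD x M p)).submoduleOf (koszulCycles x M p)

theorem koszulD_apply (x : Fin l → R) (M : Type*) [AddCommGroup M] [Module R M] (p : ℕ)
    (m : KoszulTerm M l (p + 1)) (s : Idx l p) :
    koszulD x M p m s = ∑ i : {i : Fin l // i ∉ s.1}, ((sgn s.1 i.1 : R) * x i.1) •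
      m ⟨insert i.1 s.1, by rw [Finset.card_insert_of_notMem i.2, s.2]⟩ := by
  simp [koszulD, LinearMap.sum_apply]

theorem koszulD_koszulD (x : Fin l → R) (M : Type*) [AddCommGroup M] [Module R M] (p : ℕ)
    (m : KoszulTerm M l (p + 2)) : koszulD x M p (koszulD x M (p + 1) m) = 0 := by
  funext s
  simp only [koszulD_apply, Finset.smul_sum, Pi.zero_apply]
  rw [Finset.sum_sigma']
  have hmem : ∀ a : (Σ i : {i : Fin l // i ∉ s.1}, {j : Fin l // j ∉ insert i.1 s.1}),
      a.2.1 ∉ s.1 ∧ a.1.1 ∉ insert a.2.1 s.1 ∧ a.1.1 ≠ a.2.1 := by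
    rintro ⟨⟨i, hi⟩, ⟨j, hj⟩⟩
    simp only [Finset.mem_insert, not_or] at hj ⊢
    exact ⟨hj.2, ⟨fun h => hj.1 h.symm, hi⟩, fun h => hj.1 h.symm⟩
  refine Finset.sum_involution
    (fun a _ => ⟨⟨a.2.1, (hmem a).1⟩, ⟨a.1.1, (hmem a).2.1⟩⟩) ?_ ?_ ?_ ?_
  · rintro ⟨⟨i, hi⟩, ⟨j, hj⟩⟩ -
    have hji : j ≠ i ∧ j ∉ s.1 := by simpa using hj
    have hset : insert i (insert j s.1) = insert j (insert i s.1) := Finset.insert_comm _ _ _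
    have e1 : (insert j (insert i s.1)).erase j = insert i s.1 := Finset.erase_insert hj
    have e2 : (insert j (insert i s.1)).erase i = insert j s.1 := by
      rw [← hset, Finset.erase_insert]
      simp [hi, hji.1.symm]
    have hs1 : sgn (insert i s.1) i = sgn s.1 i := by
      simp [sgn, Finset.filter_insert]
    have hs2 : sgn (insert j s.1) j = sgn s.1 j := by
      simp [sgn, Finset.filter_insert]
    have hs3 : sgn (insert j (insert i s.1)) j = sgn (insert i s.1) j := by
      simp [sgn, Finset.filter_insert]
    have hs4 : sgn (insert j (insert i s.1)) i = sgn (insert j s.1) i := by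
      rw [← hset]
      simp [sgn, Finset.filter_insert]
    have hsg := sgn_mul_sgn (t := insert j (insert i s.1)) (i := i) (j := j)
      (by simp) (by simp) hji.1.symm
    rw [e1, e2, hs1, hs2, hs3, hs4] at hsg
    simp only [hset, smul_smul, ← add_smul]
    convert zero_smul R _
    have hsg' : ((sgn (insert j s.1) i * sgn s.1 j + sgn (insert i s.1) j * sgn s.1 i : ℤ) : R)
        = 0 := by
      rw [hsg]; simp
    push_cast at hsg'
    linear_combination (x i * x j) * hsg'
  · intro a _ _ h
    exact (hmem a).2.2 (congrArg (fun b => b.1.1) h).symm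
  · intro a _
    simp
  · intro a _
    rfl

/-- The degree `p` component of the chain map `φ : K(x^m, M) → K(x^n, M)`, `n ≤ m`: the tensor
product over `i` of the maps that are `x_i ^ (m - n)` in degree one and the identity in degree
zero, hence multiplication by `∏ i ∈ s, x_i ^ (m - n)` on the summand of index `s`. -/
def koszulMap (x : Fin l → R) (M : Type*) [AddCommGroup M] [Module R M] (m n p : ℕ) :
    KoszulTerm M l p →ₗ[R] KoszulTerm M l p :=
  LinearMap.pi fun s => (∏ i ∈ s.1, x i ^ (m - n)) • LinearMap.proj s

theorem koszulD_koszulMap (x : Fin l → R) (M : Type*) [AddCommGroup M] [Module R M] {m n : ℕ}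
    (h : n ≤ m) (p : ℕ) (z : KoszulTerm M l (p + 1)) :
    koszulD (fun i => x i ^ n) M p (koszulMap x M m n (p + 1) z) =
      koszulMap x M m n p (koszulD (fun i => x i ^ m) M p z) := by
  funext s
  simp only [koszulD_apply, koszulMap, LinearMap.pi_apply, LinearMap.smul_apply,
    LinearMap.proj_apply, Finset.smul_sum]
  refine Finset.sum_congr rfl fun i _ => ?_
  rw [Finset.prod_insert i.2, smul_smul, smul_smul]
  congr 1
  have : x i.1 ^ m = x i.1 ^ n * x i.1 ^ (m - n) := by rw [← pow_add, Nat.add_sub_cancel' h]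
  rw [this]
  ring

theorem koszulMap_mem_cycles (x : Fin l → R) (M : Type*) [AddCommGroup M] [Module R M] {m n : ℕ}
    (h : n ≤ m) (p : ℕ) (z : KoszulTerm M l p) (hz : z ∈ koszulCycles (fun i => x i ^ m) M p) :
    koszulMap x M m n p z ∈ koszulCycles (fun i => x i ^ n) M p := by
  cases p with
  | zero => trivial
  | succ p =>
    change koszulD _ M p _ = 0
    rw [koszulD_koszulMap x M h, show koszulD _ M p z = 0 from hz, map_zero]

/-- The homomorphism `H_p(x^m, M) → H_p(x^n, M)` induced by the chain map `koszulMap`. -/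
def koszulHomologyMap (x : Fin l → R) (M : Type*) [AddCommGroup M] [Module R M] {m n : ℕ}
    (h : n ≤ m) (p : ℕ) :
    KoszulHomology (fun i => x i ^ m) M p →ₗ[R] KoszulHomology (fun i => x i ^ n) M p :=
  Submodule.mapQ _ _
    ((koszulMap x M m n p).restrict fun z hz => koszulMap_mem_cycles x M h p z hz) (by
      rintro ⟨z, hz⟩ ⟨w, hw⟩
      exact ⟨koszulMap x M m n (p + 1) w, by
        rw [koszulD_koszulMap x M h, hw]; rfl⟩)

/-- The sequence `x` is `M`-weakly proregular: for each `n` there is `m ≥ n` such that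
`H_i(x^m, M) → H_i(x^n, M)` is zero for all `i ≥ 1`. -/
def IsWeaklyProregular (x : Fin l → R) (M : Type*) [AddCommGroup M] [Module R M] : Prop :=
  ∀ n : ℕ, ∃ (m : ℕ) (h : n ≤ m), ∀ i : ℕ, 1 ≤ i → koszulHomologyMap x M h i = 0

end Koszul

section Cech

variable {R : Type*} [CommRing R] {l : ℕ}

/-- The localization of `M` at the product of the `x_i`, `i ∈ s`. -/
abbrev CechLoc (x : Fin l → R) (M : Type*) [AddCommGroup M] [Module R M]
    (s : Finset (Fin l)) : Type _ :=
  LocalizedModule (Submonoid.powers (∏ i ∈ s, x i)) M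

theorem isUnit_cechLoc (x : Fin l → R) (M : Type*) [AddCommGroup M] [Module R M]
    {s t : Finset (Fin l)} (h : s ⊆ t) (a : Submonoid.powers (∏ i ∈ s, x i)) :
    IsUnit (algebraMap R (Module.End R (CechLoc x M t)) a) := by
  obtain ⟨_, k, rfl⟩ := a
  have hu : IsUnit (algebraMap R (Module.End R (CechLoc x M t)) ((∏ i ∈ t, x i) ^ k)) :=
    IsLocalizedModule.map_units (LocalizedModule.mkLinearMap (Submonoid.powers (∏ i ∈ t, x i)) M)
      (⟨_, k, rfl⟩ : Submonoid.powers (∏ i ∈ t, x i))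
  have hp : (∏ i ∈ t, x i) ^ k = (∏ i ∈ s, x i) ^ k * (∏ i ∈ t \ s, x i) ^ k := by
    rw [← mul_pow, mul_comm, Finset.prod_sdiff h]
  rw [hp, map_mul] at hu
  change IsUnit (algebraMap R (Module.End R (CechLoc x M t)) ((∏ i ∈ s, x i) ^ k))
  have hc : Commute (algebraMap R (Module.End R (CechLoc x M t)) ((∏ i ∈ s, x i) ^ k))
      (algebraMap R (Module.End R (CechLoc x M t)) ((∏ i ∈ t \ s, x i) ^ k)) :=
    Algebra.commutes _ _
  exact (hc.isUnit_mul_iff.1 hu).1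

/-- For `s ⊆ t`, the natural localization map from `M` localized at `∏ i ∈ s, x_i` to `M` localized
at `∏ i ∈ t, x_i`; it sends `m / 1` to `m / 1`. -/
noncomputable def cechRes (x : Fin l → R) (M : Type*) [AddCommGroup M] [Module R M]
    {s t : Finset (Fin l)} (h : s ⊆ t) : CechLoc x M s →ₗ[R] CechLoc x M t :=
  LocalizedModule.lift (Submonoid.powers (∏ i ∈ s, x i))
    (LocalizedModule.mkLinearMap (Submonoid.powers (∏ i ∈ t, x i)) M)
    (isUnit_cechLoc x M h)

theorem cechRes_cechRes (x : Fin l → R) (M : Type*) [AddCommGroup M] [Module R M]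
    {s t u : Finset (Fin l)} (h : s ⊆ t) (h' : t ⊆ u) (z : CechLoc x M s) :
    cechRes x M h' (cechRes x M h z) = cechRes x M (h.trans h') z := by
  have : (cechRes x M h').comp (cechRes x M h) = cechRes x M (h.trans h') := by
    refine (LocalizedModule.lift_unique _ _ (isUnit_cechLoc x M (h.trans h')) _ ?_).symm
    simp only [cechRes]
    rw [LinearMap.comp_assoc, LocalizedModule.lift_comp, LocalizedModule.lift_comp]
  exact LinearMap.congr_fun this z

/-- The degree `p` term of the Čech complex `C(x; M)`: the direct sum of the localizations of `M`
at the products of `p` terms of the sequence. -/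
abbrev CechTerm (x : Fin l → R) (M : Type*) [AddCommGroup M] [Module R M] (p : ℕ) : Type _ :=
  (s : Idx l p) → CechLoc x M s.1

/-- The Čech differential `C^p(x; M) → C^{p+1}(x; M)`: the component of `d m` at `t` is
`∑ i ∈ t, ± m_{t \ {i}}`. -/
noncomputable def cechD (x : Fin l → R) (M : Type*) [AddCommGroup M] [Module R M] (p : ℕ) :
    CechTerm x M p →ₗ[R] CechTerm x M (p + 1) :=
  LinearMap.pi fun t => ∑ i : {i : Fin l // i ∈ t.1},
    (sgn t.1 i.1 : R) • (cechRes x M (Finset.erase_subset i.1 t.1)).comp (LinearMap.proj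
      (⟨t.1.erase i.1, by rw [Finset.card_erase_of_mem i.2, t.2, Nat.add_sub_cancel]⟩ : Idx l p))

theorem cechD_apply (x : Fin l → R) (M : Type*) [AddCommGroup M] [Module R M] (p : ℕ)
    (m : CechTerm x M p) (t : Idx l (p + 1)) :
    cechD x M p m t = ∑ i : {i : Fin l // i ∈ t.1}, (sgn t.1 i.1 : R) •
      cechRes x M (Finset.erase_subset i.1 t.1)
        (m ⟨t.1.erase i.1, by rw [Finset.card_erase_of_mem i.2, t.2, Nat.add_sub_cancel]⟩) := by
  simp [cechD, LinearMap.sum_apply]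

theorem cechD_cechD (x : Fin l → R) (M : Type*) [AddCommGroup M] [Module R M] (p : ℕ)
    (m : CechTerm x M p) : cechD x M (p + 1) (cechD x M p m) = 0 := by
  funext t
  simp only [cechD_apply, Finset.smul_sum, Pi.zero_apply, map_sum, map_smul, cechRes_cechRes]
  rw [Finset.sum_sigma']
  have hmem : ∀ a : (Σ i : {i : Fin l // i ∈ t.1}, {j : Fin l // j ∈ t.1.erase i.1}),
      a.2.1 ∈ t.1 ∧ a.1.1 ∈ t.1.erase a.2.1 ∧ a.1.1 ≠ a.2.1 := by
    rintro ⟨⟨i, hi⟩, ⟨j, hj⟩⟩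
    simp only [Finset.mem_erase] at hj ⊢
    exact ⟨hj.2, ⟨fun h => hj.1 h.symm, hi⟩, fun h => hj.1 h.symm⟩
  have aux : ∀ (s s' : Idx l p) (hs : s.1 ⊆ t.1) (hs' : s'.1 ⊆ t.1), s = s' →
      cechRes x M hs (m s) = cechRes x M hs' (m s') := by
    rintro s _ _ _ rfl
    rfl
  refine Finset.sum_involution
    (fun a _ => ⟨⟨a.2.1, (hmem a).1⟩, ⟨a.1.1, (hmem a).2.1⟩⟩) ?_ ?_ ?_ ?_
  · rintro ⟨⟨i, hi⟩, ⟨j, hj⟩⟩ -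
    have hji : j ≠ i ∧ j ∈ t.1 := by simpa using hj
    have hsg := sgn_mul_sgn hi hji.2 hji.1.symm
    rw [aux ⟨(t.1.erase j).erase i, _⟩ ⟨(t.1.erase i).erase j, by
      rw [Finset.card_erase_of_mem hj, Finset.card_erase_of_mem hi, t.2]; rfl⟩ _
      ((Finset.erase_subset _ _).trans (Finset.erase_subset _ _))
      (Subtype.ext Finset.erase_right_comm)]
    rw [smul_smul, smul_smul, ← add_smul, ← Int.cast_mul, ← Int.cast_mul, ← Int.cast_add, hsg,
      Int.cast_zero, zero_smul]
  · intro a _ _ h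
    exact (hmem a).2.2 (congrArg (fun b => b.1.1) h).symm
  · intro a _
    simp
  · intro a _
    rfl

/-- The coboundaries of the Čech complex in degree `p`. -/
noncomputable def cechBoundaries (x : Fin l → R) (M : Type*) [AddCommGroup M] [Module R M] :
    (p : ℕ) → Submodule R (CechTerm x M p)
  | 0 => ⊥
  | p + 1 => LinearMap.range (cechD x M p)

/-- The Čech cohomology `H^p_x(M)`, cocycles modulo coboundaries. -/
abbrev CechCohomology (x : Fin l → R) (M : Type*) [AddCommGroup M] [Module R M] (p : ℕ) :
    Type _ :=
  LinearMap.ker (cechD x M p) ⧸ (cechBoundaries x M p).submoduleOf (LinearMap.ker (cechD x M p))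

end Cech

/-- The finite sequence `x` of length `l` is a parameter sequence on `M`: it is `M`-weakly
proregular, `xM ≠ M`, and `H^l_x(M)` localized at `p` is nonzero for all primes `p` in the
support of `M / xM`. -/
structure IsParameterSequence {R : Type*} [CommRing R] {l : ℕ} (x : Fin l → R)
    (M : Type*) [AddCommGroup M] [Module R M] : Prop where
  weaklyProregular : IsWeaklyProregular x M
  smul_ne_top : Ideal.span (Set.range x) • (⊤ : Submodule R M) ≠ ⊤
  nontrivial_localization :
    ∀ p ∈ Module.support R (M ⧸ Ideal.span (Set.range x) • (⊤ : Submodule R M)),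
      Nontrivial (LocalizedModule p.asIdeal.primeCompl (CechCohomology x M l))

/-- The height `ht_M p` of a prime `p` on `M`: the Krull dimension of the `R_p`-module `M_p`. -/
noncomputable def primeHeightOn {R : Type*} [CommRing R] (M : Type*) [AddCommGroup M]
    [Module R M] (p : PrimeSpectrum R) : WithBot ℕ∞ :=
  Module.supportDim (Localization.AtPrime p.asIdeal) (LocalizedModule p.asIdeal.primeCompl M)

/-- The height `ht_M I` of an ideal `I` on `M`: the infimum of `ht_M p` over the primes
`p ∈ Supp M ∩ V(I)`; it is `⊤` if there are none. -/
noncomputable def heightOn {R : Type*} [CommRing R] (M : Type*) [AddCommGroup M]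
    [Module R M] (I : Ideal R) : WithBot ℕ∞ :=
  ⨅ p ∈ Module.support R M ∩ PrimeSpectrum.zeroLocus (I : Set R), primeHeightOn M p

end ParamSeq

/-!
Part 1. If `M` has dimension less than `l` at `p`, then `H^l_x(M)_p = 0`. Inverting the elements
`a ^ N * (1 + a * b)` of a ring lowers its dimension, so inverting them successively for
`x 0, …, x (l - 1)` annihilates a module of dimension less than `l`. This yields, for every
`m : M`, a relation which expresses `m / (∏ i, x i) ^ n` as a Čech boundary.

Part 2. Over a Noetherian ring weak proregularity is automatic: by Artin–Rees a Koszul cycle with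
coefficients in a high power of `(x)` lies in `(x ^ n)` times the cycles, and `(x ^ n)` annihilates
Koszul homology. A height equal to `l` also forces `H^l_x(M)_p ≠ 0`. At a minimal prime of the
support of `M ⧸ (x)M` the sequence cuts out the closed point, so by right exactness of `H^d` it is
enough to prove `H^d(A ⧸ P) ≠ 0` for a prime `P` of dimension `d`. Suppose that it vanishes and let
`J` be an ideal not contained in `P`. Choose `Q ⊇ P` of dimension `d - 1` with `J ⊄ Q`, so that
`H^{d-1}(A ⧸ Q) ≠ 0` by induction. Since `J + Q` has dimension less than `d - 1`, the map from
`H^{d-1}(A ⧸ P)` to `H^{d-1}(A ⧸ J) × H^{d-1}(A ⧸ Q)` is surjective, hence replacing `J` by `J ∩ Q`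
strictly shrinks the kernel of `H^{d-1}(A ⧸ P) → H^{d-1}(A ⧸ J)`. This contradicts the descending
chain condition in `H^{d-1}(A ⧸ P)`.
-/


namespace ParamSeq

universe u v

section Boundary

variable {A : Type*} [CommRing A]

/-- The submonoid of the elements `a ^ N * (1 + a * b)`. Its localization is the ring of the
*boundary* of `a` in the sense of Coquand and Lombardi, whose Krull dimension is smaller than
that of `A`. -/
def boundarySubmonoid (a : A) : Submonoid A where
  carrier := {s | ∃ N b, s = a ^ N * (1 + a * b)}
  one_mem' := ⟨0, 0, by simp⟩
  mul_mem' := by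
    rintro _ _ ⟨N, b, rfl⟩ ⟨N', b', rfl⟩
    exact ⟨N + N', b + b' + a * b * b', by ring⟩

theorem exists_lt_of_disjoint_boundarySubmonoid {a : A} {p : PrimeSpectrum A}
    (hp : Disjoint (boundarySubmonoid a : Set A) (p.asIdeal : Set A)) : ∃ q, p < q := by
  have ha : a ∉ p.asIdeal := Set.disjoint_left.1 hp ⟨1, 0, by simp⟩
  have hne : p.asIdeal ⊔ Ideal.span {a} ≠ ⊤ := fun htop => by
    obtain ⟨y, hy, z, hz, hyz⟩ := Submodule.mem_sup.1 ((Ideal.eq_top_iff_one _).1 htop)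
    obtain ⟨b, rfl⟩ := Ideal.mem_span_singleton'.1 hz
    exact Set.disjoint_left.1 hp ⟨0, -b, by linear_combination hyz⟩ hy
  obtain ⟨m, hm, hle⟩ := Ideal.exists_le_maximal _ hne
  have ham : a ∈ m := hle (Ideal.mem_sup_right (Ideal.mem_span_singleton_self a))
  exact ⟨⟨m, hm.isPrime⟩, (le_sup_left.trans hle : p.asIdeal ≤ m), fun h => ha (h ham)⟩

theorem ringKrullDim_localization_boundarySubmonoid_lt (a : A) {l : ℕ}
    (h : ringKrullDim A < ((l + 1 : ℕ) : WithBot ℕ∞)) :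
    ringKrullDim (Localization (boundarySubmonoid a)) < (l : WithBot ℕ∞) := by
  set B := Localization (boundarySubmonoid a)
  by_contra! hB
  obtain ⟨c, hc⟩ := Order.le_krullDim_iff.1 hB
  have hmono : StrictMono (PrimeSpectrum.comap (algebraMap A B)) :=
    Monotone.strictMono_of_injective (fun p q hpq => Ideal.comap_mono hpq)
      (PrimeSpectrum.localization_comap_injective B (boundarySubmonoid a))
  have hdisj : PrimeSpectrum.comap (algebraMap A B) c.last ∈
      {p | Disjoint (boundarySubmonoid a : Set A) p.asIdeal} :=
    PrimeSpectrum.localization_comap_range B (boundarySubmonoid a) ▸ Set.mem_range_self c.last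
  obtain ⟨q, hq⟩ := exists_lt_of_disjoint_boundarySubmonoid hdisj
  exact h.not_ge (Order.le_krullDim_iff.2 ⟨(c.map _ hmono).snoc q hq, congrArg (· + 1) hc⟩)

theorem mul_prod_pow_mem_span_pow_of_le {ι : Type*} [Fintype ι] (x : ι → A) {k K : ℕ} (h : k ≤ K)
    {s : A} (hs : s * (∏ i, x i) ^ k ∈ Ideal.span (Set.range fun i => x i ^ (k + 1))) :
    s * (∏ i, x i) ^ K ∈ Ideal.span (Set.range fun i => x i ^ (K + 1)) := by
  obtain ⟨j, rfl⟩ := Nat.exists_eq_add_of_le h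
  obtain ⟨c, hc⟩ := Ideal.mem_span_range_iff_exists_fun.1 hs
  rw [pow_add, ← mul_assoc, ← hc, Finset.sum_mul]
  refine Ideal.sum_mem _ fun i _ => ?_
  obtain ⟨y, hy⟩ := Finset.dvd_prod_of_mem x (Finset.mem_univ i)
  rw [show c i * x i ^ (k + 1) * (∏ i, x i) ^ j = c i * y ^ j * x i ^ (k + j + 1) by rw [hy]; ring]
  exact Ideal.mul_mem_left _ _ (Ideal.subset_span ⟨i, rfl⟩)

theorem prod_pow_mem_span_of_boundary {l : ℕ} (x : Fin (l + 1) → A) {k N : ℕ} {b : A}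
    (h : x 0 ^ N * (1 + x 0 * b) * (∏ i : Fin l, x i.succ) ^ k ∈
      Ideal.span (Set.range fun i : Fin l => x i.succ ^ (k + 1))) :
    ∃ K, (∏ i, x i) ^ K ∈ Ideal.span (Set.range fun i => x i ^ (K + 1)) := by
  refine ⟨max k N, ?_⟩
  have hle : Ideal.span (Set.range fun i : Fin l => x i.succ ^ (max k N + 1)) ≤
      Ideal.span (Set.range fun i => x i ^ (max k N + 1)) :=
    Ideal.span_mono (Set.range_comp_subset_range Fin.succ fun i => x i ^ (max k N + 1))
  have hmem := hle (mul_prod_pow_mem_span_pow_of_le _ (le_max_left k N) h)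
  have hx₀ : x 0 ^ (max k N + 1) ∈ Ideal.span (Set.range fun i => x i ^ (max k N + 1)) :=
    Ideal.subset_span ⟨0, rfl⟩
  have hsplit : (∏ i, x i) ^ max k N =
      x 0 ^ (max k N - N) * (x 0 ^ N * (1 + x 0 * b) * (∏ i : Fin l, x i.succ) ^ max k N) -
        b * (∏ i : Fin l, x i.succ) ^ max k N * x 0 ^ (max k N + 1) := by
    rw [Fin.prod_univ_succ, mul_pow, pow_succ (x 0),
      ← Nat.sub_add_cancel (le_max_right k N), pow_add (x 0), Nat.sub_add_cancel (le_max_right k N)]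
    ring
  rw [hsplit]
  exact sub_mem (Ideal.mul_mem_left _ _ hmem) (Ideal.mul_mem_left _ _ hx₀)

end Boundary

/-- A non-Noetherian form of the vanishing of top Čech cohomology above the dimension. -/
theorem exists_prod_pow_mem_span_of_ringKrullDim_lt {l : ℕ} {A : Type*} [CommRing A]
    (x : Fin l → A) (h : ringKrullDim A < (l : WithBot ℕ∞)) :
    ∃ k, (∏ i, x i) ^ k ∈ Ideal.span (Set.range fun i => x i ^ (k + 1)) := by
  induction l generalizing A with
  | zero =>
    have : Subsingleton A := by
      by_contra hA
      rw [not_subsingleton_iff_nontrivial] at hA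
      exact ringKrullDim_nonneg_of_nontrivial.not_gt h
    exact ⟨0, Subsingleton.elim 0 ((∏ i, x i) ^ 0) ▸ zero_mem _⟩
  | succ l ih =>
    obtain ⟨k, hk⟩ := ih (fun i => algebraMap A (Localization (boundarySubmonoid (x 0))) (x i.succ))
      (ringKrullDim_localization_boundarySubmonoid_lt (x 0) h)
    have hmap : Ideal.span (Set.range fun i : Fin l =>
        algebraMap A (Localization (boundarySubmonoid (x 0))) (x i.succ) ^ (k + 1)) =
        (Ideal.span (Set.range fun i : Fin l => x i.succ ^ (k + 1))).map (algebraMap A _) := by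
      simp only [Ideal.map_span, ← Set.range_comp, Function.comp_def, map_pow]
    rw [hmap, ← map_prod, ← map_pow,
      IsLocalization.algebraMap_mem_map_algebraMap_iff (boundarySubmonoid (x 0))] at hk
    obtain ⟨_, ⟨N, b, rfl⟩, hs⟩ := hk
    exact prod_pow_mem_span_of_boundary x hs

theorem mem_span_range_smul_top_iff {R ι M : Type*} [CommRing R] [AddCommGroup M] [Module R M]
    [Fintype ι] (f : ι → R) (z : M) :
    z ∈ Ideal.span (Set.range f) • (⊤ : Submodule R M) ↔ ∃ m : ι → M, z = ∑ i, f i • m i := by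
  constructor
  · intro hz
    refine Submodule.smul_induction_on hz (fun r hr n _ => ?_) fun a b ha hb => ?_
    · obtain ⟨c, rfl⟩ := Ideal.mem_span_range_iff_exists_fun.1 hr
      exact ⟨fun i => c i • n, by simp [Finset.sum_smul, smul_smul, mul_comm]⟩
    · obtain ⟨m, rfl⟩ := ha
      obtain ⟨m', rfl⟩ := hb
      exact ⟨m + m', by simp [Finset.sum_add_distrib]⟩
  · rintro ⟨m, rfl⟩
    exact Submodule.sum_mem _ fun i _ =>
      Submodule.smul_mem_smul (Ideal.subset_span ⟨i, rfl⟩) trivial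

theorem sgn_mul_self (R : Type*) [CommRing R] {l : ℕ} (s : Finset (Fin l)) (j : Fin l) :
    (sgn s j : R) * (sgn s j : R) = 1 := by
  rw [← Int.cast_mul, sgn, ← mul_pow]
  simp

section Fractions

variable {R : Type*} [CommRing R] {l : ℕ} (x : Fin l → R) (M : Type*) [AddCommGroup M] [Module R M]

/-- The linear map `m ↦ m / (∏ i ∈ s, x i) ^ n` from `M` to a component of the Čech complex. -/
noncomputable def cechFrac (s : Finset (Fin l)) (n : ℕ) : M →ₗ[R] CechLoc x M s where
  toFun m := LocalizedModule.mk m ⟨(∏ i ∈ s, x i) ^ n, n, rfl⟩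
  map_add' m m' := by
    rw [LocalizedModule.mk_add_mk, ← smul_add, LocalizedModule.mk_cancel_common_left]
  map_smul' r m := by rw [RingHom.id_apply, LocalizedModule.smul'_mk]

theorem cechFrac_apply (s : Finset (Fin l)) (n : ℕ) (m : M) :
    cechFrac x M s n m = LocalizedModule.mk m
      (⟨(∏ i ∈ s, x i) ^ n, n, rfl⟩ : Submonoid.powers (∏ i ∈ s, x i)) := rfl

theorem cechFrac_zero (s : Finset (Fin l)) :
    cechFrac x M s 0 = LocalizedModule.mkLinearMap (Submonoid.powers (∏ i ∈ s, x i)) M :=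
  LinearMap.ext fun _ => congrArg (LocalizedModule.mk _) (Subtype.ext (pow_zero _))

theorem cechFrac_eq_zero_iff {s : Finset (Fin l)} {n : ℕ} {m : M} :
    cechFrac x M s n m = 0 ↔ ∃ k, (∏ i ∈ s, x i) ^ k • m = 0 := by
  rw [cechFrac_apply, ← LocalizedModule.zero_mk 1, LocalizedModule.mk_eq]
  simp only [smul_zero, one_smul]
  refine ⟨?_, fun ⟨k, h⟩ => ⟨⟨_, k, rfl⟩, h⟩⟩
  rintro ⟨⟨_, k, rfl⟩, h⟩
  exact ⟨k, h⟩

theorem cechFrac_add {s : Finset (Fin l)} (n k : ℕ) (m : M) :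
    cechFrac x M s (n + k) ((∏ i ∈ s, x i) ^ k • m) = cechFrac x M s n m := by
  rw [cechFrac_apply, cechFrac_apply, LocalizedModule.mk_eq]
  exact ⟨1, by simp only [one_smul, Submonoid.smul_def, smul_smul, pow_add]⟩

theorem exists_cechFrac_eq {s : Finset (Fin l)} (w : CechLoc x M s) :
    ∃ n, ∀ a, n ≤ a → ∃ m, cechFrac x M s a m = w := by
  induction w using LocalizedModule.induction_on with
  | h m d =>
    obtain ⟨_, n, rfl⟩ := d
    refine ⟨n, fun a h => ?_⟩
    obtain ⟨k, rfl⟩ := Nat.exists_eq_add_of_le h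
    exact ⟨_, cechFrac_add x M (s := s) n k m⟩

theorem exists_cechFrac_eq_forall {ι : Type*} [Finite ι] (s : ι → Finset (Fin l))
    (w : ∀ i, CechLoc x M (s i)) : ∃ n, ∀ a, n ≤ a → ∀ i, ∃ m, cechFrac x M (s i) a m = w i := by
  choose n hn using fun i => exists_cechFrac_eq x M (w i)
  have := Fintype.ofFinite ι
  exact ⟨Finset.univ.sup n, fun a ha i => hn i a ((Finset.le_sup (Finset.mem_univ i)).trans ha)⟩

theorem pow_smul_cechLoc_injective {s t : Finset (Fin l)} (h : s ⊆ t) (n : ℕ) :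
    Function.Injective fun w : CechLoc x M t => (∏ i ∈ s, x i) ^ n • w :=
  ((Module.End.isUnit_iff _).1 (isUnit_cechLoc x M h ⟨_, n, rfl⟩)).1

theorem pow_smul_cechFrac (s : Finset (Fin l)) (n : ℕ) (m : M) :
    (∏ i ∈ s, x i) ^ n • cechFrac x M s n m = cechFrac x M s 0 m := by
  rw [← map_smul]
  simpa using cechFrac_add x M 0 n m

theorem cechRes_comp_mkLinearMap {s t : Finset (Fin l)} (h : s ⊆ t) :
    cechRes x M h ∘ₗ LocalizedModule.mkLinearMap (Submonoid.powers (∏ i ∈ s, x i)) M =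
      LocalizedModule.mkLinearMap (Submonoid.powers (∏ i ∈ t, x i)) M :=
  LocalizedModule.lift_comp _ _ (isUnit_cechLoc x M h)

theorem cechRes_cechFrac {s t : Finset (Fin l)} (h : s ⊆ t) (n : ℕ) (m : M) :
    cechRes x M h (cechFrac x M s n m) = cechFrac x M t n ((∏ i ∈ t \ s, x i) ^ n • m) := by
  have hzero : cechRes x M h (cechFrac x M s 0 m) = cechFrac x M t 0 m := by
    simp only [cechFrac_zero]
    exact LinearMap.congr_fun (cechRes_comp_mkLinearMap x M h) m
  apply pow_smul_cechLoc_injective x M h n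
  apply pow_smul_cechLoc_injective x M (Finset.sdiff_subset (s := t) (t := s)) n
  simp only
  rw [← map_smul, pow_smul_cechFrac, hzero, smul_smul, ← mul_pow, Finset.prod_sdiff h,
    pow_smul_cechFrac, map_smul]

end Fractions

section Classes

variable {R : Type*} [CommRing R] {l : ℕ} (x : Fin l → R) (M : Type*) [AddCommGroup M] [Module R M]

/-- The map sending a Čech cocycle to its cohomology class. -/
noncomputable def cechClass (p : ℕ) : LinearMap.ker (cechD x M p) →ₗ[R] CechCohomology x M p :=
  Submodule.mkQ _

theorem cechClass_surjective (p : ℕ) : Function.Surjective (cechClass x M p) :=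
  Submodule.mkQ_surjective _

theorem cechClass_eq_zero_iff {p : ℕ} {c : LinearMap.ker (cechD x M p)} :
    cechClass x M p c = 0 ↔ c.1 ∈ cechBoundaries x M p :=
  Submodule.Quotient.mk_eq_zero _

end Classes

section Top

variable {R : Type*} [CommRing R] {l : ℕ} (x : Fin l → R) (M : Type*) [AddCommGroup M] [Module R M]

theorem idx_self_eq_univ (s : Idx l l) : s = ⟨Finset.univ, by simp⟩ :=
  Subtype.ext ((Finset.card_eq_iff_eq_univ _).1 (by simp [s.2]))

theorem cechD_eq_zero_of_le {p : ℕ} (h : l ≤ p) : cechD x M p = 0 := by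
  refine LinearMap.ext fun c => funext fun t => absurd t.2 ?_
  have := Finset.card_le_univ t.1
  rw [Fintype.card_fin] at this
  omega

theorem cechD_univ {p : ℕ} (x : Fin (p + 1) → R) (b : CechTerm x M p) :
    cechD x M p b ⟨Finset.univ, by simp⟩ = ∑ i : Fin (p + 1), (sgn Finset.univ i : R) •
      cechRes x M (Finset.erase_subset i Finset.univ) (b ⟨Finset.univ.erase i, by simp⟩) := by
  rw [cechD_apply]
  exact Fintype.sum_equiv (Equiv.subtypeUnivEquiv fun i => Finset.mem_univ i) _ _ fun i => rfl

theorem cechRes_cechFrac_univ_erase {l : ℕ} (x : Fin l → R) (i : Fin l) (n : ℕ) (m : M) :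
    cechRes x M (Finset.erase_subset i Finset.univ) (cechFrac x M _ n m) =
      cechFrac x M Finset.univ n (x i ^ n • m) := by
  rw [cechRes_cechFrac, Finset.sdiff_erase_self (Finset.mem_univ i), Finset.prod_singleton]

/-- The element `m / (∏ i, x i) ^ n` of the Čech complex in top degree. -/
noncomputable def cechTop (n : ℕ) : M →ₗ[R] CechTerm x M l :=
  LinearMap.pi fun s => cechFrac x M s.1 n

theorem exists_cechTop_eq (c : CechTerm x M l) : ∃ n m, cechTop x M n m = c := by
  obtain ⟨n, hn⟩ := exists_cechFrac_eq x M (c ⟨Finset.univ, by simp⟩)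
  obtain ⟨m, hm⟩ := hn n le_rfl
  exact ⟨n, m, funext fun s => idx_self_eq_univ s ▸ hm⟩

theorem cechTop_mem_range_of_prod_pow_smul_mem {p : ℕ} (x : Fin (p + 1) → R) {n k : ℕ} {m : M}
    (h : (∏ i, x i) ^ k • m ∈
      Ideal.span (Set.range fun i => x i ^ (n + k)) • (⊤ : Submodule R M)) :
    cechTop x M n m ∈ LinearMap.range (cechD x M p) := by
  obtain ⟨m', hm'⟩ := (mem_span_range_smul_top_iff _ _).1 h
  refine ⟨fun s => cechFrac x M s.1 (n + k)
    (∑ i ∈ Finset.univ \ s.1, (sgn Finset.univ i : R) • m' i), funext fun s => ?_⟩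
  obtain rfl := idx_self_eq_univ s
  have hsign (i : Fin (p + 1)) : (sgn Finset.univ i : R) • x i ^ (n + k) •
      (sgn Finset.univ i : R) • m' i = x i ^ (n + k) • m' i := by
    rw [smul_comm, smul_smul (sgn _ i : R), sgn_mul_self, one_smul]
  simp only [cechD_univ, cechRes_cechFrac_univ_erase, Finset.sdiff_erase_self (Finset.mem_univ _),
    Finset.sum_singleton, ← map_smul, ← map_sum, hsign, ← hm']
  exact cechFrac_add x M n k m

theorem exists_prod_pow_smul_mem_of_cechTop_mem_range {p : ℕ} (x : Fin (p + 1) → R) {n : ℕ} {m : M}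
    (h : cechTop x M n m ∈ LinearMap.range (cechD x M p)) :
    ∃ k, (∏ i, x i) ^ k • m ∈
      Ideal.span (Set.range fun i => x i ^ (n + k)) • (⊤ : Submodule R M) := by
  obtain ⟨b, hb⟩ := h
  obtain ⟨a, ha⟩ := exists_cechFrac_eq_forall x M (fun i : Fin (p + 1) => Finset.univ.erase i)
    fun i => b ⟨Finset.univ.erase i, by simp⟩
  choose m' hm' using ha (n + a) (Nat.le_add_left _ _)
  have hfrac : cechFrac x M Finset.univ (n + a)
      (∑ i, (sgn Finset.univ i : R) • x i ^ (n + a) • m' i - (∏ i, x i) ^ a • m) = 0 := by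
    have := congrFun hb ⟨Finset.univ, by simp⟩
    simp only [cechD_univ, ← hm', cechRes_cechFrac_univ_erase, ← map_smul, ← map_sum] at this
    rw [map_sub, this, cechFrac_add, sub_eq_zero]
    rfl
  obtain ⟨c, hc⟩ := (cechFrac_eq_zero_iff x M).1 hfrac
  rw [smul_sub, sub_eq_zero, smul_smul, ← pow_add] at hc
  refine ⟨c + a, ?_⟩
  rw [← hc, Finset.smul_sum]
  refine Submodule.sum_mem _ fun i _ => ?_
  obtain ⟨y, hy⟩ := Finset.dvd_prod_of_mem x (Finset.mem_univ i)
  have hmul : (∏ i, x i) ^ c • (sgn Finset.univ i : R) • x i ^ (n + a) • m' i =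
      x i ^ (n + (c + a)) • (y ^ c * (sgn Finset.univ i : R)) • m' i := by
    rw [hy]
    module
  rw [hmul]
  exact Submodule.smul_mem_smul (Ideal.subset_span ⟨i, rfl⟩) trivial

theorem cechTop_mem_boundaries_iff {n : ℕ} {m : M} :
    cechTop x M n m ∈ cechBoundaries x M l ↔
      ∃ k, (∏ i, x i) ^ k • m ∈
        Ideal.span (Set.range fun i => x i ^ (n + k)) • (⊤ : Submodule R M) := by
  cases l with
  | zero =>
    have hinj : cechTop x M n m = 0 ↔ m = 0 := by
      refine ⟨fun h => ?_, fun h => h ▸ map_zero _⟩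
      obtain ⟨k, hk⟩ := (cechFrac_eq_zero_iff x M).1 (congrFun h ⟨∅, rfl⟩)
      simpa using hk
    rw [cechBoundaries, Submodule.mem_bot, hinj]
    simp
  | succ p =>
    exact ⟨exists_prod_pow_smul_mem_of_cechTop_mem_range M x,
      fun ⟨_, h⟩ => cechTop_mem_range_of_prod_pow_smul_mem M x h⟩

/-- The class of `m / (∏ i, x i) ^ n` in the top Čech cohomology. -/
noncomputable def cechTopClass (n : ℕ) : M →ₗ[R] CechCohomology x M l :=
  cechClass x M l ∘ₗ (cechTop x M n).codRestrict _ fun m => by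
    rw [cechD_eq_zero_of_le x M le_rfl]; rfl

theorem exists_cechTopClass_eq (c : CechCohomology x M l) : ∃ n m, cechTopClass x M n m = c := by
  obtain ⟨⟨c, hc⟩, rfl⟩ := cechClass_surjective x M l c
  obtain ⟨n, m, rfl⟩ := exists_cechTop_eq x M c
  exact ⟨n, m, rfl⟩

theorem cechTopClass_eq_zero_iff {n : ℕ} {m : M} :
    cechTopClass x M n m = 0 ↔ ∃ k, (∏ i, x i) ^ k • m ∈
      Ideal.span (Set.range fun i => x i ^ (n + k)) • (⊤ : Submodule R M) :=
  (cechClass_eq_zero_iff x M).trans (cechTop_mem_boundaries_iff x M)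

theorem subsingleton_cechCohomology_top_iff :
    Subsingleton (CechCohomology x M l) ↔ ∀ n (m : M), ∃ k, (∏ i, x i) ^ k • m ∈
      Ideal.span (Set.range fun i => x i ^ (n + k)) • (⊤ : Submodule R M) := by
  simp only [← cechTopClass_eq_zero_iff]
  refine ⟨fun h n m => Subsingleton.elim _ _, fun h => subsingleton_of_forall_eq 0 fun c => ?_⟩
  obtain ⟨n, m, rfl⟩ := exists_cechTopClass_eq x M c
  exact h n m

theorem subsingleton_localized_cechCohomology_top_iff_forall (S : Submonoid R) :
    Subsingleton (LocalizedModule S (CechCohomology x M l)) ↔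
      ∀ n (m : M), ∃ k, ∃ u ∈ S, u • (∏ i, x i) ^ k • m ∈
        Ideal.span (Set.range fun i => x i ^ (n + k)) • (⊤ : Submodule R M) := by
  have hkill (n : ℕ) (m : M) : (∃ u ∈ S, u • cechTopClass x M n m = 0) ↔
      ∃ k, ∃ u ∈ S, u • (∏ i, x i) ^ k • m ∈
        Ideal.span (Set.range fun i => x i ^ (n + k)) • (⊤ : Submodule R M) := by
    simp only [← map_smul, cechTopClass_eq_zero_iff, smul_comm _ (_ ^ _) m]
    tauto
  simp only [LocalizedModule.subsingleton_iff, ← hkill]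
  refine ⟨fun h n m => h _, fun h c => ?_⟩
  obtain ⟨n, m, rfl⟩ := exists_cechTopClass_eq x M c
  exact h n m

end Top

section TopLocalized

variable {R : Type*} [CommRing R] {l : ℕ}

theorem mk'_mem_localized'_iff {M : Type*} [AddCommGroup M] [Module R M] (A : Type*) [CommRing A]
    [Algebra R A] (S : Submonoid R) [IsLocalization S A] {N : Type*} [AddCommGroup N] [Module R N]
    [Module A N] [IsScalarTower R A N] (f : M →ₗ[R] N) [IsLocalizedModule S f]
    {P : Submodule R M} {m : M} {s : S} :
    IsLocalizedModule.mk' f m s ∈ P.localized' A S f ↔ ∃ u ∈ S, u • m ∈ P := by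
  constructor
  · rintro ⟨m', hm', s', h⟩
    obtain ⟨c, hc⟩ := (IsLocalizedModule.mk'_eq_mk'_iff f _ _ _ _).1 h
    refine ⟨c * s', (c * s').2, ?_⟩
    rw [← smul_smul]
    exact hc ▸ P.smul_mem _ (P.smul_mem _ hm')
  · rintro ⟨u, hu, h⟩
    exact ⟨u • m, h, ⟨u, hu⟩ * s, IsLocalizedModule.mk'_cancel_left f m ⟨u, hu⟩ s⟩

theorem subsingleton_localized_cechCohomology_top_iff (x : Fin l → R) (M : Type*) [AddCommGroup M]
    [Module R M] (S : Submonoid R) :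
    Subsingleton (LocalizedModule S (CechCohomology x M l)) ↔
      Subsingleton (CechCohomology (fun i => algebraMap R (Localization S) (x i))
        (LocalizedModule S M) l) := by
  have hmem (n k : ℕ) (m : M) (s : S) :
      (∏ i, algebraMap R (Localization S) (x i)) ^ k •
        IsLocalizedModule.mk' (LocalizedModule.mkLinearMap S M) m s ∈
          Ideal.span (Set.range fun i => algebraMap R (Localization S) (x i) ^ (n + k)) •
            (⊤ : Submodule (Localization S) (LocalizedModule S M)) ↔
      ∃ u ∈ S, u • (∏ i, x i) ^ k • m ∈
        Ideal.span (Set.range fun i => x i ^ (n + k)) • (⊤ : Submodule R M) := by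
    have hspan : Ideal.span (Set.range fun i => algebraMap R (Localization S) (x i) ^ (n + k)) =
        (Ideal.span (Set.range fun i => x i ^ (n + k))).map (algebraMap R (Localization S)) := by
      simp only [Ideal.map_span, ← Set.range_comp, Function.comp_def, map_pow]
    rw [hspan, ← map_prod, ← map_pow, algebraMap_smul, ← IsLocalizedModule.mk'_smul,
      ← Ideal.localized'_eq_map (Localization S) S,
      ← Submodule.localized'_top (Localization S) S (LocalizedModule.mkLinearMap S M),
      ← Submodule.localized'_smul, mk'_mem_localized'_iff]
  rw [subsingleton_localized_cechCohomology_top_iff_forall, subsingleton_cechCohomology_top_iff]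
  refine forall_congr' fun n =>
    ⟨fun h w => ?_, fun h m => (h (IsLocalizedModule.mk' _ m 1)).imp fun k => (hmem n k m 1).1⟩
  obtain ⟨⟨m, s⟩, rfl⟩ := IsLocalizedModule.mk'_surjective S (LocalizedModule.mkLinearMap S M) w
  exact (h m).imp fun k => (hmem n k m s).2

end TopLocalized

theorem ringKrullDim_quotient_annihilator_span_singleton_le {A N : Type*} [CommRing A]
    [AddCommGroup N] [Module A N] (w : N) :
    ringKrullDim (A ⧸ Module.annihilator A (Submodule.span A {w})) ≤ Module.supportDim A N := by
  rw [← Module.supportDim_eq_ringKrullDim_quotient_annihilator]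
  exact Module.supportDim_le_of_injective (Submodule.subtype _) Subtype.val_injective

theorem subsingleton_cechCohomology_top_of_supportDim_lt {A N : Type*} [CommRing A]
    [AddCommGroup N] [Module A N] {l : ℕ} (y : Fin l → A)
    (h : Module.supportDim A N < (l : WithBot ℕ∞)) : Subsingleton (CechCohomology y N l) := by
  refine (subsingleton_cechCohomology_top_iff y N).2 fun n w => ?_
  set I := Module.annihilator A (Submodule.span A {w}) with hI
  obtain ⟨k, hk⟩ := exists_prod_pow_mem_span_of_ringKrullDim_lt
    (fun i => Ideal.Quotient.mk I (y i) ^ n)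
    ((ringKrullDim_quotient_annihilator_span_singleton_le w).trans_lt h)
  have hspan : Ideal.span (Set.range fun i => (Ideal.Quotient.mk I (y i) ^ n) ^ (k + 1)) =
      (Ideal.span (Set.range fun i => y i ^ (n + n * k))).map (Ideal.Quotient.mk I) := by
    simp only [Ideal.map_span, ← Set.range_comp, Function.comp_def, map_pow, ← pow_mul,
      mul_add, mul_one, add_comm]
  rw [hspan, Finset.prod_pow, ← pow_mul, ← map_prod, ← map_pow,
    Ideal.mem_quotient_iff_mem_sup] at hk
  obtain ⟨a, ha, b, hb, hab⟩ := Submodule.mem_sup.1 hk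
  have hbw : b • w = 0 := by
    rwa [hI, Submodule.mem_annihilator_span_singleton] at hb
  refine ⟨n * k, ?_⟩
  rw [← hab, add_smul, hbw, add_zero]
  exact Submodule.smul_mem_smul ha trivial

section Koszul

variable {R : Type*} [CommRing R] {l : ℕ}

theorem sgn_insert_self (s : Finset (Fin l)) (i : Fin l) : sgn (insert i s) i = sgn s i := by
  simp [sgn, Finset.filter_insert]

theorem sgn_erase_self (s : Finset (Fin l)) (i : Fin l) : sgn (s.erase i) i = sgn s i := by
  rw [sgn, sgn, Finset.filter_erase, Finset.erase_eq_of_notMem (by simp)]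

theorem sgn_mul_sgn_insert (R : Type*) [CommRing R] {s : Finset (Fin l)} {i j : Fin l} (hi : i ∉ s)
    (hj : j ∈ s) :
    (sgn s i : R) * (sgn (insert i s) j : R) = -((sgn s j : R) * (sgn (s.erase j) i : R)) := by
  have hij : i ≠ j := fun h => hi (h ▸ hj)
  have h := sgn_mul_sgn (Finset.mem_insert_self i s) (Finset.mem_insert_of_mem hj) hij
  rw [Finset.erase_insert hi, Finset.erase_insert_of_ne hij, sgn_insert_self, sgn_insert_self] at h
  have hR : (sgn s i : R) * (sgn s j : R) +
      (sgn (insert i s) j : R) * (sgn (s.erase j) i : R) = 0 :=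
    mod_cast congrArg (Int.cast : ℤ → R) h
  linear_combination (sgn s j : R) * (sgn (insert i s) j : R) * hR -
    (sgn s i : R) * (sgn (insert i s) j : R) * sgn_mul_self R s j -
    (sgn s j : R) * (sgn (s.erase j) i : R) * sgn_mul_self R (insert i s) j

variable {M : Type*} [AddCommGroup M] [Module R M]

variable (R) in
/-- Exterior multiplication by the basis vector `e_j`, up to sign. It is a homotopy between
multiplication by `x j` and zero on the Koszul complex of any sequence `x`. -/
def koszulHomotopy (j : Fin l) (p : ℕ) (z : KoszulTerm M l p) : KoszulTerm M l (p + 1) := fun t =>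
  if h : j ∈ t.1 then (sgn t.1 j : R) • z ⟨t.1.erase j, by simp [Finset.card_erase_of_mem h, t.2]⟩
  else 0

theorem koszulHomotopy_of_mem {j : Fin l} {p : ℕ} (z : KoszulTerm M l p) {t : Idx l (p + 1)}
    {s : Idx l p} (h : j ∈ t.1) (hs : t.1.erase j = s.1) :
    koszulHomotopy R j p z t = (sgn t.1 j : R) • z s := by
  rw [koszulHomotopy, dif_pos h]
  exact congrArg _ (congrArg z (Subtype.ext hs))

theorem koszulHomotopy_of_notMem {j : Fin l} {p : ℕ} (z : KoszulTerm M l p) {t : Idx l (p + 1)}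
    (h : j ∉ t.1) : koszulHomotopy R j p z t = 0 := dif_neg h

theorem koszulD_koszulHomotopy_of_notMem (x : Fin l → R) {j : Fin l} {p : ℕ}
    (z : KoszulTerm M l p) {s : Idx l p} (hj : j ∉ s.1) :
    koszulD x M p (koszulHomotopy R j p z) s = x j • z s := by
  rw [koszulD_apply, Finset.sum_eq_single ⟨j, hj⟩]
  · rw [koszulHomotopy_of_mem z (Finset.mem_insert_self j s.1) (Finset.erase_insert hj), smul_smul,
      sgn_insert_self, mul_right_comm, sgn_mul_self, one_mul]
  · intro i _ hij
    rw [koszulHomotopy_of_notMem z, smul_zero]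
    exact fun h => (Finset.mem_insert.1 h).elim (fun h => hij (Subtype.ext h.symm)) hj
  · exact fun h => absurd (Finset.mem_univ _) h

theorem koszulD_apply_erase (x : Fin l → R) {j : Fin l} {p : ℕ}
    (z : KoszulTerm M l (p + 1)) {s : Idx l (p + 1)} (hj : j ∈ s.1) :
    koszulD x M p z ⟨s.1.erase j, by simp [Finset.card_erase_of_mem hj, s.2]⟩ =
      ((sgn s.1 j : R) * x j) • z s + ∑ i : {i // i ∉ s.1}, ((sgn (s.1.erase j) i.1 : R) * x i.1) •
        z ⟨insert i.1 (s.1.erase j), by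
          rw [Finset.card_insert_of_notMem fun h => i.2 (Finset.mem_of_mem_erase h),
            Finset.card_erase_of_mem hj, s.2]; rfl⟩ := by
  have hne (i : {i // i ∉ s.1}) : i.1 ≠ j := fun h => i.2 (h ▸ hj)
  let e : {i // i ∉ s.1} ≃ {i : {i // i ∉ s.1.erase j} // i ≠ ⟨j, by simp⟩} :=
    { toFun i := ⟨⟨i.1, fun h => i.2 (Finset.mem_of_mem_erase h)⟩,
        fun h => hne i (congrArg Subtype.val h)⟩
      invFun i := ⟨i.1.1, fun h => i.1.2 (Finset.mem_erase.2 ⟨fun h => i.2 (Subtype.ext h), h⟩)⟩ }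
  rw [koszulD_apply, Fintype.sum_eq_add_sum_subtype_ne _ ⟨j, by simp⟩, ← e.sum_comp]
  simp only [sgn_erase_self, Finset.insert_erase hj]
  rfl

theorem koszulD_koszulHomotopy_of_mem (x : Fin l → R) {j : Fin l} {p : ℕ}
    (z : KoszulTerm M l (p + 1)) {s : Idx l (p + 1)} (hj : j ∈ s.1) :
    koszulD x M (p + 1) (koszulHomotopy R j (p + 1) z) s + (sgn s.1 j : R) •
      koszulD x M p z ⟨s.1.erase j, by simp [Finset.card_erase_of_mem hj, s.2]⟩ = x j • z s := by
  rw [koszulD_apply_erase x z hj, koszulD_apply, smul_add, smul_smul, ← mul_assoc,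
    sgn_mul_self, one_mul, add_left_comm, Finset.smul_sum, ← Finset.sum_add_distrib,
    Finset.sum_eq_zero, add_zero]
  intro i _
  have hij : i.1 ≠ j := fun h => i.2 (h ▸ hj)
  rw [koszulHomotopy_of_mem z (Finset.mem_insert_of_mem hj) (s := ⟨insert i.1 (s.1.erase j), by
      rw [Finset.card_insert_of_notMem fun h => i.2 (Finset.mem_of_mem_erase h),
        Finset.card_erase_of_mem hj, s.2]; rfl⟩) (Finset.erase_insert_of_ne hij),
    smul_smul, smul_smul, ← add_smul]
  convert zero_smul R _
  linear_combination x i.1 * sgn_mul_sgn_insert R i.2 hj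

theorem smul_mem_range_koszulD (x : Fin l → R) (j : Fin l) {p : ℕ} {z : KoszulTerm M l (p + 1)}
    (hz : z ∈ koszulCycles x M (p + 1)) : x j • z ∈ LinearMap.range (koszulD x M (p + 1)) := by
  refine ⟨koszulHomotopy R j (p + 1) z, funext fun s => ?_⟩
  by_cases hj : j ∈ s.1
  · have h := koszulD_koszulHomotopy_of_mem x z hj
    rwa [show koszulD x M p z = 0 from hz, Pi.zero_apply, smul_zero, add_zero] at h
  · exact koszulD_koszulHomotopy_of_notMem x z hj

theorem span_smul_koszulCycles_le (x : Fin l → R) (p : ℕ) :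
    Ideal.span (Set.range x) • koszulCycles x M (p + 1) ≤
      LinearMap.range (koszulD x M (p + 1)) := by
  refine Submodule.smul_le.2 fun r hr z hz => ?_
  obtain ⟨c, rfl⟩ := Ideal.mem_span_range_iff_exists_fun.1 hr
  rw [Finset.sum_smul]
  refine Submodule.sum_mem _ fun j _ => ?_
  rw [mul_smul]
  exact Submodule.smul_mem _ _ (smul_mem_range_koszulD x j hz)

theorem koszulMap_mem_pow_smul_top (x : Fin l → R) (m n p : ℕ) (z : KoszulTerm M l (p + 1)) :
    koszulMap x M m n (p + 1) z ∈
      Ideal.span (Set.range x) ^ (m - n) • (⊤ : Submodule R (KoszulTerm M l (p + 1))) := by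
  rw [← Finset.univ_sum_single (koszulMap x M m n (p + 1) z)]
  refine Submodule.sum_mem _ fun s _ => ?_
  obtain ⟨i, hi⟩ : s.1.Nonempty := Finset.card_pos.1 (by simp [s.2])
  have hmem : x i ∈ Ideal.span (Set.range x) := Ideal.subset_span ⟨i, rfl⟩
  have hcoef : ∏ i ∈ s.1, x i ^ (m - n) ∈ Ideal.span (Set.range x) ^ (m - n) :=
    Ideal.mem_of_dvd _ (Finset.dvd_prod_of_mem _ hi) (Ideal.pow_mem_pow hmem _)
  have hsingle : Pi.single s (koszulMap x M m n (p + 1) z s) =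
      (∏ i ∈ s.1, x i ^ (m - n)) • (Pi.single s (z s) : KoszulTerm M l (p + 1)) :=
    Pi.single_smul s _ _
  rw [hsingle]
  exact Submodule.smul_mem_smul hcoef trivial

theorem exists_span_pow_le_span_pow (x : Fin l → R) (n : ℕ) :
    ∃ c, Ideal.span (Set.range x) ^ c ≤ Ideal.span (Set.range fun i => x i ^ n) := by
  refine Ideal.exists_pow_le_of_le_radical_of_fg ?_ (Submodule.fg_span (Set.finite_range x))
  rw [Ideal.span_le]
  rintro _ ⟨i, rfl⟩
  exact ⟨n, Ideal.subset_span ⟨i, rfl⟩⟩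

variable (M) in
theorem exists_koszulHomologyMap_eq_zero [IsNoetherianRing R] [Module.Finite R M] (x : Fin l → R)
    (n p : ℕ) : ∃ k, ∀ (m : ℕ) (h : n ≤ m), n + k ≤ m → koszulHomologyMap x M h (p + 1) = 0 := by
  set I := Ideal.span (Set.range x)
  set Z := koszulCycles (fun i => x i ^ n) M (p + 1)
  obtain ⟨a, ha⟩ := I.exists_pow_inf_eq_pow_smul Z
  obtain ⟨c, hc⟩ := exists_span_pow_le_span_pow x n
  refine ⟨a + c, fun m h hm => LinearMap.ext fun z => ?_⟩
  obtain ⟨⟨z, hz⟩, rfl⟩ := Submodule.Quotient.mk_surjective _ z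
  have hmem : koszulMap x M m n (p + 1) z ∈ I ^ (m - n) • ⊤ ⊓ Z :=
    ⟨koszulMap_mem_pow_smul_top x m n p z, koszulMap_mem_cycles x M h _ z hz⟩
  have hle : I ^ (m - n) • ⊤ ⊓ Z ≤ LinearMap.range (koszulD (fun i => x i ^ n) M (p + 1)) :=
    calc I ^ (m - n) • ⊤ ⊓ Z = I ^ (m - n - a) • (I ^ a • ⊤ ⊓ Z) := ha _ (by omega)
      _ ≤ I ^ c • Z := Submodule.smul_mono (Ideal.pow_le_pow_right (by omega)) inf_le_right
      _ ≤ Ideal.span (Set.range fun i => x i ^ n) • Z := Submodule.smul_mono_left hc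
      _ ≤ _ := span_smul_koszulCycles_le _ p
  exact (Submodule.Quotient.mk_eq_zero _).2 (hle hmem)

variable (M) in
theorem isWeaklyProregular_of_isNoetherianRing [IsNoetherianRing R] [Module.Finite R M]
    (x : Fin l → R) : IsWeaklyProregular x M := by
  intro n
  choose k hk using exists_koszulHomologyMap_eq_zero M x n
  refine ⟨n + (Finset.range l).sup k, Nat.le_add_right _ _, fun i hi => ?_⟩
  obtain ⟨p, rfl⟩ := Nat.exists_eq_add_of_le' hi
  rcases lt_or_ge p l with hp | hp
  · exact hk p _ _ (Nat.add_le_add_left (Finset.le_sup (Finset.mem_range.2 hp)) n)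
  · have : IsEmpty (Idx l (p + 1)) := ⟨fun s => by
      have := s.2 ▸ Finset.card_le_univ s.1
      rw [Fintype.card_fin] at this
      omega⟩
    refine LinearMap.ext fun z => ?_
    obtain ⟨z, rfl⟩ := Submodule.Quotient.mk_surjective _ z
    rw [Subsingleton.elim z 0, Submodule.Quotient.mk_zero, map_zero, map_zero]

end Koszul

section Torsion

variable {R : Type*} [CommRing R] {l : ℕ} (x : Fin l → R) {M : Type*} [AddCommGroup M] [Module R M]

theorem exists_pow_smul_eq_zero_of_cechRes_insert_eq_zero {s : Finset (Fin l)} {j : Fin l}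
    (hj : j ∉ s) {w : CechLoc x M s} (hw : cechRes x M (Finset.subset_insert j s) w = 0) :
    ∃ k, x j ^ k • w = 0 := by
  obtain ⟨n, hn⟩ := exists_cechFrac_eq x M w
  obtain ⟨m, rfl⟩ := hn n le_rfl
  rw [cechRes_cechFrac, cechFrac_eq_zero_iff, Finset.insert_sdiff_cancel hj,
    Finset.prod_singleton, Finset.prod_insert hj] at hw
  obtain ⟨k, hk⟩ := hw
  refine ⟨k + n, ?_⟩
  rw [← map_smul, cechFrac_eq_zero_iff]
  refine ⟨k, ?_⟩
  rw [← hk]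
  module

theorem cechD_apply_insert {p : ℕ} {j : Fin l} {c : CechTerm x M p}
    (hc : ∀ s : Idx l p, j ∈ s.1 → c s = 0) {s : Idx l p} {t : Idx l (p + 1)} (hj : j ∉ s.1)
    (ht : insert j s.1 = t.1) : cechD x M p c t =
      (sgn t.1 j : R) • cechRes x M (ht ▸ Finset.subset_insert j s.1) (c s) := by
  have hjt : j ∈ t.1 := ht ▸ Finset.mem_insert_self j s.1
  obtain rfl : s = ⟨t.1.erase j, by simp [Finset.card_erase_of_mem hjt, t.2]⟩ :=
    Subtype.ext ((Finset.erase_insert hj).symm.trans (congrArg (Finset.erase · j) ht))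
  rw [cechD_apply, Fintype.sum_eq_single ⟨j, hjt⟩]
  intro i hi
  rw [hc _ (Finset.mem_erase.2 ⟨fun h => hi (Subtype.ext h.symm), hjt⟩), map_zero, smul_zero]

theorem exists_pow_smul_eq_zero_of_cechD_eq_zero {p : ℕ} {j : Fin l} {c : CechTerm x M p}
    (hd : cechD x M p c = 0) (hc : ∀ s : Idx l p, j ∈ s.1 → c s = 0) : ∃ k, x j ^ k • c = 0 := by
  have hcomp (s : Idx l p) : ∃ k, x j ^ k • c s = 0 := by
    by_cases hj : j ∈ s.1
    · exact ⟨0, by rw [hc s hj, smul_zero]⟩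
    · refine exists_pow_smul_eq_zero_of_cechRes_insert_eq_zero x hj ?_
      have h := cechD_apply_insert x hc (t := ⟨_, by rw [Finset.card_insert_of_notMem hj, s.2]⟩)
        hj rfl
      rw [hd, Pi.zero_apply] at h
      rw [← one_smul R (cechRes x M _ _), ← sgn_mul_self R (insert j s.1) j, mul_smul, ← h,
        smul_zero]
  choose k hk using hcomp
  refine ⟨Finset.univ.sup k, funext fun s => ?_⟩
  obtain ⟨d, hd⟩ := Nat.exists_eq_add_of_le (Finset.le_sup (f := k) (Finset.mem_univ s))
  rw [Pi.smul_apply, hd, pow_add, mul_comm, mul_smul, hk, smul_zero, Pi.zero_apply]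

theorem exists_pow_smul_eq_cechD {p : ℕ} (j : Fin l) (z : CechTerm x M (p + 1)) :
    ∃ (a : ℕ) (c : CechTerm x M p), ∀ t : Idx l (p + 1), j ∈ t.1 →
      x j ^ a • z t = cechD x M p c t := by
  obtain ⟨a, ha⟩ := exists_cechFrac_eq_forall x M (fun t : Idx l (p + 1) => t.1) z
  choose b hb using ha a le_rfl
  let c : CechTerm x M p := fun s => if hj : j ∈ s.1 then 0 else cechFrac x M s.1 a
    ((sgn (insert j s.1) j : R) • b ⟨_, by rw [Finset.card_insert_of_notMem hj, s.2]⟩)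
  refine ⟨a, c, fun ⟨t, ht⟩ hj => ?_⟩
  let s : Idx l p := ⟨t.erase j, by simp [Finset.card_erase_of_mem hj, ht]⟩
  have hs : j ∉ s.1 := Finset.notMem_erase j t
  have hcs : c s = cechFrac x M s.1 a ((sgn t j : R) • b ⟨t, ht⟩) := by
    simp only [c, dif_neg hs, s, Finset.insert_erase hj]
  have hc (s : Idx l p) (hs : j ∈ s.1) : c s = 0 := dif_pos hs
  rw [cechD_apply_insert x hc hs (Finset.insert_erase hj), hcs,
    cechRes_cechFrac, Finset.sdiff_erase_self hj, Finset.prod_singleton, ← hb, ← map_smul,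
    ← map_smul]
  congr 1
  rw [smul_comm (x j ^ a), smul_smul, sgn_mul_self, one_smul]

theorem exists_pow_smul_mem_cechBoundaries {p : ℕ} (j : Fin l) {z : CechTerm x M p}
    (hz : cechD x M p z = 0) : ∃ k, x j ^ k • z ∈ cechBoundaries x M p := by
  cases p with
  | zero =>
    obtain ⟨k, hk⟩ := exists_pow_smul_eq_zero_of_cechD_eq_zero (j := j) x hz fun s hs =>
      absurd hs (Finset.card_eq_zero.1 s.2 ▸ Finset.notMem_empty j)
    exact ⟨k, hk ▸ zero_mem _⟩
  | succ p =>
    obtain ⟨a, c, hc⟩ := exists_pow_smul_eq_cechD x j z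
    obtain ⟨k, hk⟩ := exists_pow_smul_eq_zero_of_cechD_eq_zero
      (c := x j ^ a • z - cechD x M p c) (j := j) x
      (by rw [map_sub, map_smul, hz, smul_zero, cechD_cechD, sub_zero])
      fun t ht => sub_eq_zero.2 (hc t ht)
    rw [smul_sub, sub_eq_zero, smul_smul, ← pow_add] at hk
    exact ⟨k + a, x j ^ k • c, by rw [map_smul, hk]⟩

theorem exists_pow_smul_cechCohomology_eq_zero {p : ℕ} (j : Fin l) (c : CechCohomology x M p) :
    ∃ k, x j ^ k • c = 0 := by
  obtain ⟨⟨z, hz⟩, rfl⟩ := cechClass_surjective x M p c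
  obtain ⟨k, hk⟩ := exists_pow_smul_mem_cechBoundaries x j hz
  exact ⟨k, by rwa [← map_smul, cechClass_eq_zero_iff]⟩

end Torsion

section Functoriality

variable {R : Type*} [CommRing R] {l : ℕ} (x : Fin l → R)
  {M : Type*} [AddCommGroup M] [Module R M] {N : Type*} [AddCommGroup N] [Module R N]
  {P : Type*} [AddCommGroup P] [Module R P]

/-- The map between the localizations at `∏ i ∈ s, x i` induced by a linear map, as a linear
function of that map. -/
noncomputable def cechLocMap (s : Finset (Fin l)) :
    (M →ₗ[R] N) →ₗ[R] CechLoc x M s →ₗ[R] CechLoc x N s :=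
  IsLocalizedModule.map (Submonoid.powers (∏ i ∈ s, x i)) (LocalizedModule.mkLinearMap _ M)
    (LocalizedModule.mkLinearMap _ N)

theorem cechLocMap_cechFrac (s : Finset (Fin l)) (f : M →ₗ[R] N) (n : ℕ) (m : M) :
    cechLocMap x s f (cechFrac x M s n m) = cechFrac x N s n (f m) :=
  IsLocalizedModule.map_LocalizedModules _ _ _ _

theorem cechLocMap_cechRes {s t : Finset (Fin l)} (h : s ⊆ t) (f : M →ₗ[R] N) (w : CechLoc x M s) :
    cechLocMap x t f (cechRes x M h w) = cechRes x N h (cechLocMap x s f w) := by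
  obtain ⟨n, hn⟩ := exists_cechFrac_eq x M w
  obtain ⟨m, rfl⟩ := hn n le_rfl
  simp only [cechRes_cechFrac, cechLocMap_cechFrac, map_smul]

/-- The map of Čech complexes in degree `p` induced by a linear map, as a linear function of that
map. -/
noncomputable def cechMap (p : ℕ) : (M →ₗ[R] N) →ₗ[R] CechTerm x M p →ₗ[R] CechTerm x N p where
  toFun f := LinearMap.pi fun s => cechLocMap x s.1 f ∘ₗ LinearMap.proj s
  map_add' f g := by simp only [map_add]; rfl
  map_smul' r f := by simp only [map_smul]; rfl

theorem cechMap_apply (f : M →ₗ[R] N) {p : ℕ} (c : CechTerm x M p) (s : Idx l p) :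
    cechMap x p f c s = cechLocMap x s.1 f (c s) := rfl

theorem cechD_cechMap (f : M →ₗ[R] N) {p : ℕ} (c : CechTerm x M p) :
    cechD x N p (cechMap x p f c) = cechMap x (p + 1) f (cechD x M p c) := by
  funext t
  simp only [cechD_apply, cechMap_apply, map_sum, map_smul, cechLocMap_cechRes]

theorem cechMap_injective {f : M →ₗ[R] N} (hf : Function.Injective f) (p : ℕ) :
    Function.Injective (cechMap x p f) :=
  Function.Injective.piMap fun s : Idx l p =>
    IsLocalizedModule.map_injective (Submonoid.powers (∏ i ∈ s.1, x i)) _ _ f hf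

theorem cechMap_surjective {f : M →ₗ[R] N} (hf : Function.Surjective f) (p : ℕ) :
    Function.Surjective (cechMap x p f) :=
  Function.Surjective.piMap fun s : Idx l p =>
    IsLocalizedModule.map_surjective (Submonoid.powers (∏ i ∈ s.1, x i)) _ _ f hf

theorem cechMap_exact {f : M →ₗ[R] N} {g : N →ₗ[R] P} (h : Function.Exact f g) (p : ℕ) :
    Function.Exact (cechMap x p f) (cechMap x p g) := by
  have hs (s : Idx l p) := LocalizedModule.map_exact (Submonoid.powers (∏ i ∈ s.1, x i)) f g h
  refine fun c => ⟨fun hc => ?_, ?_⟩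
  · choose b hb using fun s : Idx l p => (hs s (c s)).1 (congrFun hc s)
    exact ⟨b, funext hb⟩
  · rintro ⟨b, rfl⟩
    exact funext fun s => (hs s _).2 ⟨b s, rfl⟩

theorem cechMap_comp (f : M →ₗ[R] N) (g : N →ₗ[R] P) {p : ℕ} (c : CechTerm x M p) :
    cechMap x p (g ∘ₗ f) c = cechMap x p g (cechMap x p f c) :=
  funext fun s => LinearMap.congr_fun (IsLocalizedModule.map_comp'
    (Submonoid.powers (∏ i ∈ s.1, x i)) (LocalizedModule.mkLinearMap _ M)
    (LocalizedModule.mkLinearMap _ N) (LocalizedModule.mkLinearMap _ P) f g) (c s)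

theorem cechMap_id {p : ℕ} (c : CechTerm x M p) : cechMap x p .id c = c :=
  funext fun _ => LinearMap.congr_fun (IsLocalizedModule.map_id _ _) _

theorem cechMap_mem_cechBoundaries (f : M →ₗ[R] N) {p : ℕ} {c : CechTerm x M p}
    (hc : c ∈ cechBoundaries x M p) : cechMap x p f c ∈ cechBoundaries x N p := by
  cases p with
  | zero =>
    rw [show c = 0 from hc, map_zero]
    exact zero_mem _
  | succ p =>
    obtain ⟨b, rfl⟩ := hc
    exact ⟨cechMap x p f b, cechD_cechMap x f b⟩

theorem exists_mem_cechBoundaries_cechMap_eq {f : M →ₗ[R] N} (hf : Function.Surjective f) {p : ℕ}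
    {c : CechTerm x N p} (hc : c ∈ cechBoundaries x N p) :
    ∃ b ∈ cechBoundaries x M p, cechMap x p f b = c := by
  cases p with
  | zero => exact ⟨0, zero_mem _, by rw [map_zero, show c = 0 from hc]⟩
  | succ p =>
    obtain ⟨c, rfl⟩ := hc
    obtain ⟨b, rfl⟩ := cechMap_surjective x hf p c
    exact ⟨_, ⟨b, rfl⟩, (cechD_cechMap x f b).symm⟩

theorem cechD_eq_zero_of_mem_cechBoundaries {p : ℕ} {c : CechTerm x M p}
    (hc : c ∈ cechBoundaries x M p) : cechD x M p c = 0 := by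
  cases p with
  | zero => rw [show c = 0 from hc, map_zero]
  | succ p =>
    obtain ⟨b, rfl⟩ := hc
    exact cechD_cechD x M p b

/-- The map on Čech cocycles induced by a linear map. -/
noncomputable def cechCocycleMap (f : M →ₗ[R] N) (p : ℕ) :
    LinearMap.ker (cechD x M p) →ₗ[R] LinearMap.ker (cechD x N p) :=
  (cechMap x p f).restrict fun c hc => by
    rw [LinearMap.mem_ker] at hc ⊢
    rw [cechD_cechMap, hc, map_zero]

/-- The map on Čech cohomology induced by a linear map. -/
noncomputable def cechCohomologyMap (f : M →ₗ[R] N) (p : ℕ) :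
    CechCohomology x M p →ₗ[R] CechCohomology x N p :=
  Submodule.mapQ _ _ (cechCocycleMap x f p) fun _ hc => cechMap_mem_cechBoundaries x f hc

theorem cechCohomologyMap_cechClass (f : M →ₗ[R] N) {p : ℕ} (z : LinearMap.ker (cechD x M p)) :
    cechCohomologyMap x f p (cechClass x M p z) = cechClass x N p (cechCocycleMap x f p z) := rfl

theorem cechCohomologyMap_comp (f : M →ₗ[R] N) (g : N →ₗ[R] P) {p : ℕ}
    (c : CechCohomology x M p) :
    cechCohomologyMap x (g ∘ₗ f) p c = cechCohomologyMap x g p (cechCohomologyMap x f p c) := by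
  obtain ⟨z, rfl⟩ := cechClass_surjective x M p c
  exact congrArg (cechClass x P p) (Subtype.ext (cechMap_comp x f g z.1))

theorem cechCohomologyMap_zero {p : ℕ} (c : CechCohomology x M p) :
    cechCohomologyMap x (0 : M →ₗ[R] N) p c = 0 := by
  obtain ⟨z, rfl⟩ := cechClass_surjective x M p c
  exact congrArg (cechClass x N p) (Subtype.ext (LinearMap.congr_fun (map_zero (cechMap x p)) z.1))

theorem cechCohomologyMap_lsmul (r : R) (p : ℕ) :
    cechCohomologyMap x (LinearMap.lsmul R M r) p = LinearMap.lsmul R _ r := by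
  refine LinearMap.ext fun c => ?_
  obtain ⟨z, rfl⟩ := cechClass_surjective x M p c
  have hz : cechMap x p (LinearMap.lsmul R M r) z.1 = r • z.1 := by
    rw [show LinearMap.lsmul R M r = r • LinearMap.id from rfl, map_smul, LinearMap.smul_apply,
      cechMap_id]
  exact congrArg (cechClass x M p) (Subtype.ext hz)

theorem cechCohomologyMap_id {p : ℕ} (c : CechCohomology x M p) :
    cechCohomologyMap x .id p c = c := by
  obtain ⟨z, rfl⟩ := cechClass_surjective x M p c
  exact congrArg (cechClass x M p) (Subtype.ext (cechMap_id x z.1))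

theorem cechCohomologyMap_surjective_of_equiv (e : M ≃ₗ[R] N) (p : ℕ) :
    Function.Surjective (cechCohomologyMap x e.toLinearMap p) := by
  refine fun c => ⟨cechCohomologyMap x e.symm.toLinearMap p c, ?_⟩
  rw [← cechCohomologyMap_comp, e.comp_symm]
  exact cechCohomologyMap_id x c

end Functoriality

section LongExactSequence

variable {R : Type*} [CommRing R] {l : ℕ} (x : Fin l → R)

/-- The Čech differential, with values in the cocycles. -/
noncomputable def cechDiffToCocycles (M : Type*) [AddCommGroup M] [Module R M] (p : ℕ) :
    CechTerm x M p →ₗ[R] LinearMap.ker (cechD x M (p + 1)) :=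
  (cechD x M p).codRestrict _ fun c => LinearMap.mem_ker.2 (cechD_cechD x M p c)

theorem exact_subtype_cechDiffToCocycles (M : Type*) [AddCommGroup M] [Module R M] (p : ℕ) :
    Function.Exact (LinearMap.ker (cechD x M p)).subtype (cechDiffToCocycles x M p) := by
  rw [LinearMap.exact_iff, Submodule.range_subtype, cechDiffToCocycles, LinearMap.ker_codRestrict]

theorem exact_cechDiffToCocycles_cechClass (M : Type*) [AddCommGroup M] [Module R M] (p : ℕ) :
    Function.Exact (cechDiffToCocycles x M p) (cechClass x M (p + 1)) := fun _ =>
  (cechClass_eq_zero_iff x M).trans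
    ⟨fun ⟨b, hb⟩ => ⟨b, Subtype.ext hb⟩, fun ⟨b, hb⟩ => ⟨b, congrArg Subtype.val hb⟩⟩

variable {M : Type*} [AddCommGroup M] [Module R M] {N : Type*} [AddCommGroup N] [Module R N]
  {P : Type*} [AddCommGroup P] [Module R P] {f : M →ₗ[R] N} {g : N →ₗ[R] P}

theorem cechCocycleMap_injective (hf : Function.Injective f) (p : ℕ) :
    Function.Injective (cechCocycleMap x f p) := fun _ _ h =>
  Subtype.ext (cechMap_injective x hf p (congrArg Subtype.val h))

theorem cechCocycleMap_exact (hf : Function.Injective f) (h : Function.Exact f g) (p : ℕ) :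
    Function.Exact (cechCocycleMap x f p) (cechCocycleMap x g p) := by
  intro z
  rw [Subtype.ext_iff]
  refine (cechMap_exact x h p z.1).trans ⟨fun ⟨c, hc⟩ => ⟨⟨c, ?_⟩, Subtype.ext hc⟩,
    fun ⟨c, hc⟩ => ⟨c.1, congrArg Subtype.val hc⟩⟩
  apply cechMap_injective x hf (p + 1)
  rw [← cechD_cechMap, hc, map_zero]
  exact z.2

theorem cechCohomologyMap_exact (hf : Function.Injective f) (hg : Function.Surjective g)
    (h : Function.Exact f g) (p : ℕ) :
    Function.Exact (cechCohomologyMap x f p) (cechCohomologyMap x g p) := by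
  refine fun c => ⟨fun hc => ?_, ?_⟩
  · obtain ⟨z, rfl⟩ := cechClass_surjective x N p c
    obtain ⟨b, hb, hbz⟩ := exists_mem_cechBoundaries_cechMap_eq x hg
      ((cechClass_eq_zero_iff x P).1 hc)
    let b' : LinearMap.ker (cechD x N p) := ⟨b, cechD_eq_zero_of_mem_cechBoundaries x hb⟩
    obtain ⟨a, ha⟩ := (cechCocycleMap_exact x hf h p (z - b')).1 (by
      rw [map_sub, sub_eq_zero]
      exact Subtype.ext hbz.symm)
    refine ⟨cechClass x M p a, ?_⟩
    rw [cechCohomologyMap_cechClass, ha, map_sub, (cechClass_eq_zero_iff x N (c := b')).2 hb,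
      sub_zero]
  · rintro ⟨c, rfl⟩
    rw [← cechCohomologyMap_comp, h.linearMap_comp_eq_zero, cechCohomologyMap_zero]

/-- The snake map from the cocycles `Z^p(P)` to `H^{p+1}(M)` attached to a short exact sequence
`0 → M → N → P → 0`, before passing to the quotient `H^p(P)`. -/
noncomputable def cechConnectingCocycle (hf : Function.Injective f) (hg : Function.Surjective g)
    (h : Function.Exact f g) (p : ℕ) :
    LinearMap.ker (cechD x P p) →ₗ[R] CechCohomology x M (p + 1) :=
  SnakeLemma.δ' (cechDiffToCocycles x M p) (cechDiffToCocycles x N p) (cechDiffToCocycles x P p)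
    (cechMap x p f) (cechMap x p g) (cechMap_exact x h p) (cechCocycleMap x f (p + 1))
    (cechCocycleMap x g (p + 1)) (cechCocycleMap_exact x hf h (p + 1))
    (LinearMap.ext fun c => Subtype.ext (cechD_cechMap x f c).symm)
    (LinearMap.ext fun c => Subtype.ext (cechD_cechMap x g c).symm)
    (LinearMap.ker (cechD x P p)).subtype (exact_subtype_cechDiffToCocycles x P p)
    (cechClass x M (p + 1)) (exact_cechDiffToCocycles_cechClass x M p)
    (cechMap_surjective x hg p) (cechCocycleMap_injective x hf (p + 1))

theorem exact_cechCocycleMap_cechConnectingCocycle (hf : Function.Injective f)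
    (hg : Function.Surjective g) (h : Function.Exact f g) (p : ℕ) :
    Function.Exact (cechCocycleMap x g p) (cechConnectingCocycle x hf hg h p) :=
  SnakeLemma.exact_δ'_right _ _ _ _ _ _ _ _ _ _ _ _ (exact_subtype_cechDiffToCocycles x N p)
    _ _ _ _ _ _ _ rfl Subtype.val_injective

theorem exact_cechConnectingCocycle_cechCohomologyMap (hf : Function.Injective f)
    (hg : Function.Surjective g) (h : Function.Exact f g) (p : ℕ) :
    Function.Exact (cechConnectingCocycle x hf hg h p) (cechCohomologyMap x f (p + 1)) :=
  SnakeLemma.exact_δ'_left _ _ _ _ _ _ _ _ _ _ _ _ _ _ _ _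
    (exact_cechDiffToCocycles_cechClass x N p) _ _ _ rfl (cechClass_surjective x M (p + 1))

/-- The connecting map `H^p(P) → H^{p+1}(M)` of a short exact sequence `0 → M → N → P → 0`. -/
noncomputable def cechConnecting (hf : Function.Injective f) (hg : Function.Surjective g)
    (h : Function.Exact f g) (p : ℕ) : CechCohomology x P p →ₗ[R] CechCohomology x M (p + 1) :=
  Submodule.liftQ _ (cechConnectingCocycle x hf hg h p) fun z hz => by
    obtain ⟨b, hb, hbz⟩ := exists_mem_cechBoundaries_cechMap_eq x hg hz
    exact (exact_cechCocycleMap_cechConnectingCocycle x hf hg h p z).2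
      ⟨⟨b, cechD_eq_zero_of_mem_cechBoundaries x hb⟩, Subtype.ext hbz⟩

theorem exact_cechCohomologyMap_cechConnecting (hf : Function.Injective f)
    (hg : Function.Surjective g) (h : Function.Exact f g) (p : ℕ) :
    Function.Exact (cechCohomologyMap x g p) (cechConnecting x hf hg h p) := by
  have hcocycle := exact_cechCocycleMap_cechConnectingCocycle x hf hg h p
  refine fun c => ⟨fun hc => ?_, ?_⟩
  · obtain ⟨z, rfl⟩ := cechClass_surjective x P p c
    obtain ⟨y, rfl⟩ := (hcocycle z).1 hc
    exact ⟨cechClass x N p y, rfl⟩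
  · rintro ⟨c, rfl⟩
    obtain ⟨y, rfl⟩ := cechClass_surjective x N p c
    exact hcocycle.apply_apply_eq_zero y

theorem exact_cechConnecting_cechCohomologyMap (hf : Function.Injective f)
    (hg : Function.Surjective g) (h : Function.Exact f g) (p : ℕ) :
    Function.Exact (cechConnecting x hf hg h p) (cechCohomologyMap x f (p + 1)) := by
  rw [LinearMap.exact_iff, cechConnecting, Submodule.range_liftQ]
  exact (exact_cechConnectingCocycle_cechCohomologyMap x hf hg h p).linearMap_ker_eq

theorem cechCohomologyMap_surjective_of_subsingleton_succ (hf : Function.Injective f)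
    (hg : Function.Surjective g) (h : Function.Exact f g) (p : ℕ)
    [Subsingleton (CechCohomology x M (p + 1))] :
    Function.Surjective (cechCohomologyMap x g p) := fun c =>
  (exact_cechCohomologyMap_cechConnecting x hf hg h p c).1 (Subsingleton.elim _ _)

theorem cechCohomologyMap_surjective_of_ker_of_range (f : M →ₗ[R] N) (p : ℕ)
    [Subsingleton (CechCohomology x (LinearMap.ker f) (p + 1))]
    [Subsingleton (CechCohomology x (N ⧸ LinearMap.range f) p)] :
    Function.Surjective (cechCohomologyMap x f p) := by
  have hker : Function.Exact (LinearMap.ker f).subtype f.rangeRestrict := by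
    rw [LinearMap.exact_iff, LinearMap.ker_rangeRestrict, Submodule.range_subtype]
  have honto := cechCohomologyMap_surjective_of_subsingleton_succ x
    Subtype.val_injective f.surjective_rangeRestrict hker p
  intro c
  obtain ⟨b, rfl⟩ := (cechCohomologyMap_exact x Subtype.val_injective
    (Submodule.mkQ_surjective _) (LinearMap.exact_subtype_mkQ (LinearMap.range f)) p c).1
    (Subsingleton.elim _ _)
  obtain ⟨a, rfl⟩ := honto b
  exact ⟨a, cechCohomologyMap_comp x f.rangeRestrict (LinearMap.range f).subtype a⟩

end LongExactSequence

section Artinian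

theorem exists_forall_ge_eq_of_antitone {α : Type*} [PartialOrder α] [WellFoundedLT α]
    {u : ℕ → α} (hu : Antitone u) : ∃ n, ∀ k, n ≤ k → u n = u k :=
  WellFoundedGT.monotone_chain_condition (α := αᵒᵈ) ⟨u, hu⟩

theorem exists_forall_forall_ge_le_of_antitone {α : Type*} [PartialOrder α] [WellFoundedLT α]
    {u : ℕ → ℕ → α} (hu : ∀ ⦃n n' k k'⦄, n ≤ n' → k ≤ k' → u n' k' ≤ u n k) :
    ∃ K, ∀ n k, K ≤ k → u n K ≤ u n k := by
  obtain ⟨d, hd⟩ := exists_forall_ge_eq_of_antitone (u := fun k => u k k) fun _ _ h => hu h h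
  choose t ht using fun n => exists_forall_ge_eq_of_antitone (u := u n) fun _ _ h => hu le_rfl h
  refine ⟨max d ((Finset.range d).sup t), fun n k hk => ?_⟩
  rcases lt_or_ge n d with hn | hn
  · have htn := (Finset.le_sup (f := t) (Finset.mem_range.2 hn)).trans (le_max_right d _)
    rw [← ht n _ htn, ← ht n k (htn.trans hk)]
  · calc u n (max d ((Finset.range d).sup t)) ≤ u d d := hu hn (le_max_left _ _)
      _ = u (max n k) (max n k) := hd _ (hn.trans (le_max_left _ _))
      _ ≤ u n k := hu (le_max_left _ _) (le_max_right _ _)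

variable {R : Type*} [CommRing R] {M : Type*} [AddCommGroup M] [Module R M]

theorem le_of_forall_map_pow_inf_ker_le {y : R} {N N' : Submodule R M} (hle : N' ≤ N)
    (htors : ∀ m ∈ N, ∃ k, y ^ k • m = 0)
    (h : ∀ n, N.map (LinearMap.lsmul R M (y ^ n)) ⊓ LinearMap.ker (LinearMap.lsmul R M y) ≤
      N'.map (LinearMap.lsmul R M (y ^ n))) : N ≤ N' := by
  intro m hm
  obtain ⟨k, hk⟩ := htors m hm
  induction k generalizing m with
  | zero =>
    rw [pow_zero, one_smul] at hk
    exact hk ▸ zero_mem N'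
  | succ k ih =>
    obtain ⟨m', hm', hmm'⟩ := h k ⟨⟨m, hm, rfl⟩, by
      rwa [SetLike.mem_coe, LinearMap.mem_ker, LinearMap.lsmul_apply, LinearMap.lsmul_apply,
        smul_smul, ← pow_succ']⟩
    have hsub := ih (N.sub_mem hm (hle hm')) (by
      rw [smul_sub, sub_eq_zero]
      exact hmm'.symm)
    exact (Submodule.sub_mem_iff_left N' hm').1 hsub

theorem isArtinian_of_isArtinian_ker_lsmul {y : R} (htors : ∀ m : M, ∃ k, y ^ k • m = 0)
    [IsArtinian R (LinearMap.ker (LinearMap.lsmul R M y))] : IsArtinian R M := by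
  rw [← monotone_stabilizes_iff_artinian]
  intro f
  have hf {a b} (hab : a ≤ b) : (f b).ofDual ≤ (f a).ofDual := f.monotone hab
  obtain ⟨K, hK⟩ := exists_forall_forall_ge_le_of_antitone
    (u := fun n k => ((f k).ofDual.map (LinearMap.lsmul R M (y ^ n))).submoduleOf
      (LinearMap.ker (LinearMap.lsmul R M y))) (by
    rintro n n' k k' hn hk c ⟨m, hm, hmc⟩
    refine ⟨y ^ (n' - n) • m, hf hk (Submodule.smul_mem _ _ hm), ?_⟩
    rw [← hmc, LinearMap.lsmul_apply, LinearMap.lsmul_apply, smul_smul, ← pow_add,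
      Nat.add_sub_cancel' hn])
  refine ⟨K, fun k hk => (hf hk).antisymm' ?_⟩
  exact le_of_forall_map_pow_inf_ker_le (y := y) (hf hk) (fun m _ => htors m)
    fun n c hc => hK n k hk (x := ⟨c, hc.2⟩) hc.1

end Artinian

section LowDegree

variable {R : Type*} [CommRing R] {l : ℕ} (x : Fin l → R)
  {M : Type*} [AddCommGroup M] [Module R M] {N : Type*} [AddCommGroup N] [Module R N]

theorem subsingleton_cechCohomology_of_subsingleton_cechTerm {p : ℕ}
    [Subsingleton (CechTerm x M p)] : Subsingleton (CechCohomology x M p) :=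
  (cechClass_surjective x M p).subsingleton

theorem subsingleton_cechCohomology_of_subsingleton [Subsingleton M] (p : ℕ) :
    Subsingleton (CechCohomology x M p) :=
  have (s : Idx l p) : Subsingleton (CechLoc x M s.1) := inferInstance
  subsingleton_cechCohomology_of_subsingleton_cechTerm x

theorem subsingleton_cechTerm_succ_of_smul_eq_zero (h : ∀ j (m : M), x j • m = 0) (p : ℕ) :
    Subsingleton (CechTerm x M (p + 1)) := by
  refine subsingleton_of_forall_eq 0 fun c => funext fun s => ?_
  obtain ⟨n, hn⟩ := exists_cechFrac_eq x M (c s)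
  obtain ⟨m, hm⟩ := hn n le_rfl
  obtain ⟨j, hj⟩ := Finset.card_pos.1 (p.succ_pos.trans_eq s.2.symm)
  rw [← hm]
  refine (cechFrac_eq_zero_iff x M).2 ⟨1, ?_⟩
  rw [pow_one, ← Finset.prod_erase_mul _ _ hj, mul_smul, h, smul_zero]

theorem subsingleton_cechCohomology_succ_of_smul_eq_zero (h : ∀ j (m : M), x j • m = 0) (p : ℕ) :
    Subsingleton (CechCohomology x M (p + 1)) :=
  have := subsingleton_cechTerm_succ_of_smul_eq_zero x h p
  subsingleton_cechCohomology_of_subsingleton_cechTerm x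

theorem cechFrac_empty_bijective :
    Function.Bijective (cechFrac x M (∅ : Finset (Fin l)) 0) := by
  refine ⟨(injective_iff_map_eq_zero _).2 fun m hm => ?_, fun w => ?_⟩
  · obtain ⟨k, hk⟩ := (cechFrac_eq_zero_iff x M).1 hm
    rwa [Finset.prod_empty, one_pow, one_smul] at hk
  · obtain ⟨n, hn⟩ := exists_cechFrac_eq x M w
    obtain ⟨m, rfl⟩ := hn n le_rfl
    exact ⟨m, by simpa using (cechFrac_add x M 0 n m (s := ∅)).symm⟩

/-- The identification of `M` with the degree zero term of its Čech complex. -/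
noncomputable def cechZero (M : Type*) [AddCommGroup M] [Module R M] : M →ₗ[R] CechTerm x M 0 :=
  LinearMap.pi fun s => cechFrac x M s.1 0

theorem cechZero_bijective : Function.Bijective (cechZero x M) := by
  have hM := cechFrac_empty_bijective x (M := M)
  refine ⟨fun a b h => hM.1 (congrFun h ⟨∅, rfl⟩), fun c => ?_⟩
  obtain ⟨m, hm⟩ := hM.2 (c ⟨∅, rfl⟩)
  refine ⟨m, funext fun s => ?_⟩
  obtain rfl : s = ⟨∅, rfl⟩ := Subtype.ext (Finset.card_eq_zero.1 s.2)
  exact hm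

theorem isArtinian_cechCohomology_zero [IsArtinian R M] : IsArtinian R (CechCohomology x M 0) :=
  have := isArtinian_of_surjective _ (cechZero x M) (cechZero_bijective x).2
  isArtinian_of_surjective _ (cechClass x M 0) (cechClass_surjective x M 0)

theorem nontrivial_cechCohomology_zero [Nontrivial M] (h : ∀ j (m : M), x j • m = 0) :
    Nontrivial (CechCohomology x M 0) := by
  have := subsingleton_cechTerm_succ_of_smul_eq_zero x h 0
  obtain ⟨m, hm⟩ := exists_ne (0 : M)
  refine nontrivial_of_ne (cechClass x M 0 ⟨cechZero x M m, Subsingleton.elim _ _⟩) 0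
    fun h0 => hm ?_
  apply (cechZero_bijective x).1
  rw [map_zero]
  exact (cechClass_eq_zero_iff x M).1 h0

theorem cechCohomologyMap_zero_injective {f : M →ₗ[R] N} (hf : Function.Injective f) :
    Function.Injective (cechCohomologyMap x f 0) := by
  refine (injective_iff_map_eq_zero _).2 fun c hc => ?_
  obtain ⟨z, rfl⟩ := cechClass_surjective x M 0 c
  have hz : cechMap x 0 f z.1 = 0 := (cechClass_eq_zero_iff x N).1 hc
  exact (cechClass_eq_zero_iff x M).2 (cechMap_injective x hf 0 (hz.trans (map_zero _).symm))

end LowDegree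

section RegularElement

variable {R : Type*} [CommRing R] {l : ℕ} (x : Fin l → R)
  {M : Type*} [AddCommGroup M] [Module R M] {j : Fin l}

theorem subsingleton_cechCohomology_of_lsmul_injective {p : ℕ}
    (h : Function.Injective (LinearMap.lsmul R (CechCohomology x M p) (x j))) :
    Subsingleton (CechCohomology x M p) := by
  refine subsingleton_of_forall_eq 0 fun c => ?_
  obtain ⟨k, hk⟩ := exists_pow_smul_cechCohomology_eq_zero x j c
  exact (IsSMulRegular.pow k h).right_eq_zero_of_smul hk

theorem subsingleton_cechCohomology_zero_of_isSMulRegular (h : IsSMulRegular M (x j)) :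
    Subsingleton (CechCohomology x M 0) :=
  subsingleton_cechCohomology_of_lsmul_injective x
    (cechCohomologyMap_lsmul (M := M) x (x j) 0 ▸
      cechCohomologyMap_zero_injective x (f := LinearMap.lsmul R M (x j)) h)

theorem exact_cechConnecting_lsmul {r : R} (h : IsSMulRegular M r) (p : ℕ) :
    Function.Exact (cechConnecting x (f := LinearMap.lsmul R M r) h (Submodule.mkQ_surjective _)
      (LinearMap.exact_lsmul_mkQ_smul_top M r) p)
      (LinearMap.lsmul R (CechCohomology x M (p + 1)) r) :=
  cechCohomologyMap_lsmul (M := M) x r (p + 1) ▸ exact_cechConnecting_cechCohomologyMap x _ _ _ p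

theorem subsingleton_cechCohomology_succ_of_isSMulRegular {p : ℕ} (h : IsSMulRegular M (x j))
    [Subsingleton (CechCohomology x (QuotSMulTop (x j) M) p)] :
    Subsingleton (CechCohomology x M (p + 1)) :=
  subsingleton_cechCohomology_of_lsmul_injective x <|
    (injective_iff_map_eq_zero _).2 fun c hc => by
      obtain ⟨b, rfl⟩ := (exact_cechConnecting_lsmul x h p c).1 hc
      rw [Subsingleton.elim b 0, map_zero]

theorem isArtinian_cechCohomology_succ_of_isSMulRegular {p : ℕ} (h : IsSMulRegular M (x j))
    [IsArtinian R (CechCohomology x (QuotSMulTop (x j) M) p)] :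
    IsArtinian R (CechCohomology x M (p + 1)) := by
  have : IsArtinian R (LinearMap.ker (LinearMap.lsmul R (CechCohomology x M (p + 1)) (x j))) := by
    rw [(exact_cechConnecting_lsmul x h p).linearMap_ker_eq]
    infer_instance
  exact isArtinian_of_isArtinian_ker_lsmul (exists_pow_smul_cechCohomology_eq_zero x j)

end RegularElement

section Devissage

variable {A : Type u} [CommRing A]

theorem mem_support_quotient_iff {I : Ideal A} {Q : PrimeSpectrum A} :
    Q ∈ Module.support A (A ⧸ I) ↔ I ≤ Q.asIdeal := by
  rw [Module.mem_support_iff_of_finite, Ideal.annihilator_quotient]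

theorem isSMulRegular_quotient_of_notMem {P : PrimeSpectrum A} {a : A} (ha : a ∉ P.asIdeal) :
    IsSMulRegular (A ⧸ P.asIdeal) a :=
  (isSMulRegular_quotient_iff_mem_of_smul_mem P.asIdeal a).2 fun _ h =>
    (P.isPrime.mem_or_mem h).resolve_left ha

theorem smul_quotient_eq_zero {I : Ideal A} {a : A} (ha : a ∈ I) (m : A ⧸ I) : a • m = 0 :=
  Module.mem_annihilator.1 (I.annihilator_quotient.symm ▸ ha) m

theorem lt_of_mem_support_quotSMulTop_quotient {P Q : PrimeSpectrum A} {a : A}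
    (ha : a ∉ P.asIdeal) (hQ : Q ∈ Module.support A (QuotSMulTop a (A ⧸ P.asIdeal))) : P < Q := by
  rw [Module.support_quotSMulTop] at hQ
  refine lt_of_le_of_ne (mem_support_quotient_iff.1 hQ.1) ?_
  rintro rfl
  exact ha (hQ.2 rfl)

variable [IsNoetherianRing A]

theorem induction_on_support_subset {N : Type v} [AddCommGroup N] [Module A N]
    [hN : Module.Finite A N] {S : Set (PrimeSpectrum A)} (hS : Module.support A N ⊆ S)
    {motive : (N : Type v) → [AddCommGroup N] → [Module A N] → [Module.Finite A N] → Prop}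
    (subsingleton : ∀ (N : Type v) [AddCommGroup N] [Module A N] [Module.Finite A N]
      [Subsingleton N], motive N)
    (quotient : ∀ (N : Type v) [AddCommGroup N] [Module A N] [Module.Finite A N],
      ∀ P ∈ S, (N ≃ₗ[A] A ⧸ P.asIdeal) → motive N)
    (exact : ∀ (N₁ : Type v) [AddCommGroup N₁] [Module A N₁] [Module.Finite A N₁]
      (N₂ : Type v) [AddCommGroup N₂] [Module A N₂] [Module.Finite A N₂]
      (N₃ : Type v) [AddCommGroup N₃] [Module A N₃] [Module.Finite A N₃]
      (f : N₁ →ₗ[A] N₂) (g : N₂ →ₗ[A] N₃), Function.Injective f → Function.Surjective g →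
      Function.Exact f g → motive N₁ → motive N₃ → motive N₂) : motive N := by
  refine IsNoetherianRing.induction_on_isQuotientEquivQuotientPrime A hN
    (motive := fun N _ _ _ => Module.support A N ⊆ S → motive N) ?_ ?_ ?_ hS
  · exact fun N _ _ _ _ _ => subsingleton N
  · intro N _ _ _ P e h
    refine quotient N P (h ?_) e
    rw [e.support_eq, mem_support_quotient_iff]
  · intro N₁ _ _ _ N₂ _ _ _ N₃ _ _ _ f g hf hg hfg h₁ h₃ h
    exact exact N₁ N₂ N₃ f g hf hg hfg (h₁ ((Module.support_subset_of_injective f hf).trans h))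
      (h₃ ((Module.support_subset_of_surjective g hg).trans h))

variable {l : ℕ} (x : Fin l → A)

theorem subsingleton_cechCohomology_of_forall_quotient {i : ℕ} {S : Set (PrimeSpectrum A)}
    (h : ∀ P ∈ S, Subsingleton (CechCohomology x (A ⧸ P.asIdeal) i))
    {N : Type v} [AddCommGroup N] [Module A N] [Module.Finite A N]
    (hN : Module.support A N ⊆ S) : Subsingleton (CechCohomology x N i) := by
  refine induction_on_support_subset hN (motive := fun N _ _ _ =>
    Subsingleton (CechCohomology x N i)) ?_ ?_ ?_
  · exact fun N _ _ _ _ => subsingleton_cechCohomology_of_subsingleton x i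
  · intro N _ _ _ P hP e
    have := h P hP
    exact (cechCohomologyMap_surjective_of_equiv x e.symm i).subsingleton
  · intro N₁ _ _ _ N₂ _ _ _ N₃ _ _ _ f g hf hg hfg h₁ h₃
    refine subsingleton_of_forall_eq 0 fun c => ?_
    obtain ⟨b, rfl⟩ := (cechCohomologyMap_exact x hf hg hfg i c).1 (Subsingleton.elim _ _)
    rw [Subsingleton.elim b 0, map_zero]

theorem isArtinian_cechCohomology_of_forall_quotient {i : ℕ} {S : Set (PrimeSpectrum A)}
    (h : ∀ P ∈ S, IsArtinian A (CechCohomology x (A ⧸ P.asIdeal) i))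
    {N : Type v} [AddCommGroup N] [Module A N] [Module.Finite A N]
    (hN : Module.support A N ⊆ S) : IsArtinian A (CechCohomology x N i) := by
  refine induction_on_support_subset hN (motive := fun N _ _ _ =>
    IsArtinian A (CechCohomology x N i)) ?_ ?_ ?_
  · intro N _ _ _ _
    have := subsingleton_cechCohomology_of_subsingleton x (M := N) i
    infer_instance
  · intro N _ _ _ P hP e
    have := h P hP
    exact isArtinian_of_surjective _ _ (cechCohomologyMap_surjective_of_equiv x e.symm i)
  · intro N₁ _ _ _ N₂ _ _ _ N₃ _ _ _ f g hf hg hfg h₁ h₃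
    exact isArtinian_of_range_eq_ker (cechCohomologyMap x f i) (cechCohomologyMap x g i)
      (cechCohomologyMap_exact x hf hg hfg i).linearMap_ker_eq.symm

theorem subsingleton_cechCohomology_quotient_of_coheight_lt {i : ℕ} {P : PrimeSpectrum A}
    (hP : Order.coheight P < i) : Subsingleton (CechCohomology x (A ⧸ P.asIdeal) i) := by
  induction i generalizing P with
  | zero => exact absurd hP (by simp)
  | succ i ih =>
    by_cases hx : ∀ j, x j ∈ P.asIdeal
    · exact subsingleton_cechCohomology_succ_of_smul_eq_zero x
        (fun j => smul_quotient_eq_zero (hx j)) i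
    · obtain ⟨j, hj⟩ := not_forall.1 hx
      have := subsingleton_cechCohomology_of_forall_quotient x (fun Q hQ => ih hQ)
        (N := QuotSMulTop (x j) (A ⧸ P.asIdeal)) fun Q hQ => by
          have hlt := (Order.coheight_add_one_le
            (lt_of_mem_support_quotSMulTop_quotient hj hQ)).trans_lt hP
          rw [Nat.cast_succ] at hlt
          exact lt_of_add_lt_add_right hlt
      exact subsingleton_cechCohomology_succ_of_isSMulRegular x
        (isSMulRegular_quotient_of_notMem hj)

theorem subsingleton_cechCohomology_of_coheight_lt {i : ℕ} {N : Type v} [AddCommGroup N]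
    [Module A N] [Module.Finite A N] (h : ∀ P ∈ Module.support A N, Order.coheight P < i) :
    Subsingleton (CechCohomology x N i) :=
  subsingleton_cechCohomology_of_forall_quotient x
    (fun _ hP => subsingleton_cechCohomology_quotient_of_coheight_lt x hP) h

theorem isArtinian_cechCohomology_quotient {i : ℕ} {P : PrimeSpectrum A}
    (hP : ∀ Q, P ≤ Q → (∀ j, x j ∈ Q.asIdeal) → Q.asIdeal.IsMaximal) :
    IsArtinian A (CechCohomology x (A ⧸ P.asIdeal) i) := by
  induction i generalizing P with
  | zero =>
    by_cases hx : ∀ j, x j ∈ P.asIdeal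
    · have : IsSimpleModule A (A ⧸ P.asIdeal) :=
        isSimpleModule_iff_isCoatom.2 (hP P le_rfl hx).out
      exact isArtinian_cechCohomology_zero x
    · obtain ⟨j, hj⟩ := not_forall.1 hx
      have := subsingleton_cechCohomology_zero_of_isSMulRegular x
        (isSMulRegular_quotient_of_notMem hj)
      infer_instance
  | succ i ih =>
    by_cases hx : ∀ j, x j ∈ P.asIdeal
    · have := subsingleton_cechCohomology_succ_of_smul_eq_zero x
        (fun j => smul_quotient_eq_zero (hx j)) i
      infer_instance
    · obtain ⟨j, hj⟩ := not_forall.1 hx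
      have := isArtinian_cechCohomology_of_forall_quotient x (S := Set.Ioi P)
        (fun Q hPQ => ih fun Q' hQ' => hP Q' (hPQ.le.trans hQ'))
        (N := QuotSMulTop (x j) (A ⧸ P.asIdeal))
        fun Q hQ => lt_of_mem_support_quotSMulTop_quotient hj hQ
      exact isArtinian_cechCohomology_succ_of_isSMulRegular x (isSMulRegular_quotient_of_notMem hj)

end Devissage

section Nonvanishing

variable {A : Type u} [CommRing A]

theorem sup_le_annihilator_coker_factor_prod_factor {I J K : Ideal A} (hJ : I ≤ J) (hK : I ≤ K) :
    J ⊔ K ≤ Module.annihilator A (((A ⧸ J) × (A ⧸ K)) ⧸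
      LinearMap.range ((Submodule.factor hJ).prod (Submodule.factor hK))) := by
  refine sup_le (fun r hr => Module.mem_annihilator.2 fun c => ?_)
    (fun r hr => Module.mem_annihilator.2 fun c => ?_)
  all_goals
    obtain ⟨⟨a, b⟩, rfl⟩ := Submodule.mkQ_surjective _ c
    obtain ⟨a, rfl⟩ := Submodule.factor_surjective hJ a
    obtain ⟨b, rfl⟩ := Submodule.factor_surjective hK b
    rw [← map_smul]
  · exact (Submodule.Quotient.mk_eq_zero _).2
      ⟨r • b, Prod.ext (by simp [smul_quotient_eq_zero hr]) (by simp)⟩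
  · exact (Submodule.Quotient.mk_eq_zero _).2
      ⟨r • a, Prod.ext (by simp) (by simp [smul_quotient_eq_zero hr])⟩

variable [IsNoetherianRing A]

theorem exists_mem_forall_mem_minimalPrimes_le (I : Ideal A) (Q : Ideal A) :
    ∃ y ∈ Q, ∀ q ∈ I.minimalPrimes, y ∈ q → Q ≤ q := by
  classical
  let F := (I.finite_minimalPrimes_of_isNoetherianRing A).toFinset.filter fun q => ¬Q ≤ q
  have havoid : ¬(Q : Set A) ⊆ ⋃ q ∈ (F : Set (Ideal A)), q := by
    rw [Ideal.subset_union_prime ⊤ ⊤ fun q hq _ _ => ?_]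
    · rintro ⟨q, hq, hle⟩
      exact (Finset.mem_filter.1 hq).2 hle
    · exact ((Set.Finite.mem_toFinset _).1 (Finset.mem_filter.1 hq).1).1.1
  obtain ⟨y, hyQ, hy⟩ := Set.not_subset.1 havoid
  refine ⟨y, hyQ, fun q hq hyq => of_not_not fun hle => hy (Set.mem_biUnion ?_ hyq)⟩
  exact Finset.mem_filter.2 ⟨(Set.Finite.mem_toFinset _).2 hq, hle⟩

theorem exists_gt_coheight_eq_not_le {P : PrimeSpectrum A} {e : ℕ}
    (hP : Order.coheight P = (e + 2 : ℕ)) {J : Ideal A} (hJ : ¬J ≤ P.asIdeal) :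
    ∃ Q, P < Q ∧ Order.coheight Q = (e + 1 : ℕ) ∧ ¬J ≤ Q.asIdeal := by
  obtain ⟨-, ⟨Q₁, hPQ₁, hQ₁⟩, hle⟩ := Order.coheight_eq_coe_add_one_iff.1
    (hP.trans (Nat.cast_succ (e + 1)))
  obtain ⟨-, ⟨Q₂, hQ₁₂, hQ₂⟩, -⟩ := Order.coheight_eq_coe_add_one_iff.1
    (hQ₁.trans (Nat.cast_succ e))
  obtain ⟨y, hyQ₂, hy⟩ :=
    exists_mem_forall_mem_minimalPrimes_le (P.asIdeal ⊔ J) Q₂.asIdeal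
  obtain ⟨Q, hyQ, hPQ, hQQ₂⟩ := PrimeSpectrum.exist_mem_one_of_mem_two hPQ₁ hQ₁₂ hyQ₂
  have hQ : Order.coheight Q = (e + 1 : ℕ) := by
    refine le_antisymm (hle Q hPQ) ?_
    rw [Nat.cast_succ, ← hQ₂]
    exact Order.coheight_add_one_le hQQ₂
  refine ⟨Q, hPQ, hQ, fun hJQ => ?_⟩
  obtain ⟨q, hq, hqQ⟩ := Ideal.exists_minimalPrimes_le (sup_le hPQ.le hJQ)
  have hPq : P < ⟨q, hq.1.1⟩ := lt_of_le_of_ne (le_sup_left.trans hq.1.2) fun h =>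
    hJ (h ▸ le_sup_right.trans hq.1.2)
  have hQq : Q ≤ ⟨q, hq.1.1⟩ := by
    by_contra hlt
    have hqQ' : (⟨q, hq.1.1⟩ : PrimeSpectrum A) < Q := lt_of_le_not_ge hqQ hlt
    have := Order.coheight_add_one_le hqQ'
    rw [hQ] at this
    exact absurd (this.trans (hle _ hPq)) (by norm_cast; omega)
  exact hQQ₂.not_ge ((hy q hq (hQq hyQ)).trans hqQ)

variable {l : ℕ} (x : Fin l → A)

theorem cechCohomologyMap_surjective_of_coheight_le {P : PrimeSpectrum A} {d : ℕ}
    (hP : Order.coheight P ≤ (d + 1 : ℕ))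
    [Subsingleton (CechCohomology x (A ⧸ P.asIdeal) (d + 1))]
    {N : Type u} [AddCommGroup N] [Module A N] [Module.Finite A N] (f : (A ⧸ P.asIdeal) →ₗ[A] N)
    (hN : ∀ Q ∈ Module.support A (N ⧸ LinearMap.range f), Order.coheight Q < d) :
    Function.Surjective (cechCohomologyMap x f d) := by
  have hquot : ∀ Q ∈ Set.Ici P, Subsingleton (CechCohomology x (A ⧸ Q.asIdeal) (d + 1)) := by
    intro Q hQ
    rcases eq_or_lt_of_le (Set.mem_Ici.1 hQ) with rfl | hPQ
    · infer_instance
    · exact subsingleton_cechCohomology_quotient_of_coheight_lt x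
        (Order.coheight_le_coe_iff.1 hP Q hPQ)
  have hker : Subsingleton (CechCohomology x (LinearMap.ker f) (d + 1)) :=
    subsingleton_cechCohomology_of_forall_quotient x hquot fun Q hQ =>
      mem_support_quotient_iff.1 <|
        Module.support_subset_of_injective _ (Submodule.subtype_injective _) hQ
  have hcoker := subsingleton_cechCohomology_of_coheight_lt x hN
  exact cechCohomologyMap_surjective_of_ker_of_range x f d

theorem exists_cechCohomologyMap_factor_eq_zero_ne_zero {P : PrimeSpectrum A} {d : ℕ}
    (hP : Order.coheight P ≤ (d + 1 : ℕ))
    [Subsingleton (CechCohomology x (A ⧸ P.asIdeal) (d + 1))] {J K : Ideal A}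
    (hJ : P.asIdeal ≤ J) (hK : P.asIdeal ≤ K) [Nontrivial (CechCohomology x (A ⧸ K) d)]
    (hJK : ∀ Q : PrimeSpectrum A, J ≤ Q.asIdeal → K ≤ Q.asIdeal → Order.coheight Q < d) :
    ∃ z : CechCohomology x (A ⧸ P.asIdeal) d,
      cechCohomologyMap x (Submodule.factor hJ) d z = 0 ∧
        cechCohomologyMap x (Submodule.factor hK) d z ≠ 0 := by
  have hsurj := cechCohomologyMap_surjective_of_coheight_le x hP
    ((Submodule.factor hJ).prod (Submodule.factor hK)) fun Q hQ => by
      have hle := (sup_le_annihilator_coker_factor_prod_factor hJ hK).trans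
        (Module.annihilator_le_of_mem_support hQ)
      exact hJK Q (le_sup_left.trans hle) (le_sup_right.trans hle)
  obtain ⟨c, hc⟩ := exists_ne (0 : CechCohomology x (A ⧸ K) d)
  obtain ⟨z, hz⟩ := hsurj (cechCohomologyMap x (LinearMap.inr A (A ⧸ J) (A ⧸ K)) d c)
  refine ⟨z, ?_, ?_⟩
  · rw [← LinearMap.fst_prod (Submodule.factor hJ) (Submodule.factor hK),
      cechCohomologyMap_comp, hz, ← cechCohomologyMap_comp, LinearMap.fst_comp_inr,
      cechCohomologyMap_zero]
  · rwa [← LinearMap.snd_prod (Submodule.factor hJ) (Submodule.factor hK),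
      cechCohomologyMap_comp, hz, ← cechCohomologyMap_comp, LinearMap.snd_comp_inr,
      cechCohomologyMap_id]

theorem nontrivial_cechCohomology_quotient_succ_of_isArtinian {P : PrimeSpectrum A} {d : ℕ}
    (hP : Order.coheight P ≤ (d + 1 : ℕ)) [IsArtinian A (CechCohomology x (A ⧸ P.asIdeal) d)]
    (hex : ∀ J : Ideal A, ¬J ≤ P.asIdeal → ∃ Q : PrimeSpectrum A, P < Q ∧ ¬J ≤ Q.asIdeal ∧
      Order.coheight Q ≤ d ∧ Nontrivial (CechCohomology x (A ⧸ Q.asIdeal) d)) :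
    Nontrivial (CechCohomology x (A ⧸ P.asIdeal) (d + 1)) := by
  by_contra hsub
  rw [not_nontrivial_iff_subsingleton] at hsub
  let kernel (J : Ideal A) (hJ : P.asIdeal ≤ J) :=
    LinearMap.ker (cechCohomologyMap x (Submodule.factor hJ) d)
  have hanti {J J' : Ideal A} (hJ' : P.asIdeal ≤ J') (h : J' ≤ J) :
      kernel J' hJ' ≤ kernel J (hJ'.trans h) := fun z hz => by
    rw [LinearMap.mem_ker] at hz ⊢
    rw [← Submodule.factor_comp hJ' h, cechCohomologyMap_comp, hz, map_zero]
  obtain ⟨_, ⟨J, hPJ, hJP, rfl⟩, hmin⟩ := IsArtinian.set_has_minimal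
    {K | ∃ (J : Ideal A) (hPJ : P.asIdeal ≤ J), ¬J ≤ P.asIdeal ∧ K = kernel J hPJ}
    ⟨_, ⊤, le_top, fun h => P.isPrime.ne_top (top_le_iff.1 h), rfl⟩
  -- Intersecting `J` with a further prime `Q` makes the kernel strictly smaller.
  obtain ⟨Q, hPQ, hJQ, hQ, hnt⟩ := hex J hJP
  have hle : P.asIdeal ≤ J ⊓ Q.asIdeal := le_inf hPJ hPQ.le
  obtain ⟨z, hzJ, hzQ⟩ := exists_cechCohomologyMap_factor_eq_zero_ne_zero x hP hPJ hPQ.le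
    fun Q' hJQ' hQQ' => Order.coheight_le_coe_iff.1 hQ Q' <|
      lt_of_le_of_ne hQQ' fun h => hJQ (h ▸ hJQ')
  have hinf : ¬J ⊓ Q.asIdeal ≤ P.asIdeal := fun h =>
    (P.isPrime.inf_le.1 h).elim hJP hPQ.not_ge
  refine hmin _ ⟨J ⊓ Q.asIdeal, hle, hinf, rfl⟩ <|
    lt_of_le_not_ge (hanti hle inf_le_left) fun hge => hzQ ?_
  exact hanti hle inf_le_right (hge hzJ)

theorem nontrivial_cechCohomology_quotient_one {P Q : PrimeSpectrum A} (hPQ : P < Q)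
    (hP : Order.coheight P ≤ 1) {j : Fin l} (hj : x j ∉ P.asIdeal)
    [Nontrivial (CechCohomology x (A ⧸ Q.asIdeal) 0)] :
    Nontrivial (CechCohomology x (A ⧸ P.asIdeal) 1) := by
  by_contra hsub
  rw [not_nontrivial_iff_subsingleton] at hsub
  have := subsingleton_cechCohomology_zero_of_isSMulRegular x (isSMulRegular_quotient_of_notMem hj)
  obtain ⟨z, -, hz⟩ := exists_cechCohomologyMap_factor_eq_zero_ne_zero x (d := 0)
    (by simpa using hP) le_top hPQ.le fun Q' hQ' => absurd (top_le_iff.1 hQ') Q'.isPrime.ne_top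
  exact hz (by rw [Subsingleton.elim z 0, map_zero])

theorem nontrivial_cechCohomology_quotient_prime {d : ℕ} {P : PrimeSpectrum A}
    (hx : ∀ Q, P ≤ Q → ((∀ j, x j ∈ Q.asIdeal) ↔ Q.asIdeal.IsMaximal))
    (hP : Order.coheight P = d) : Nontrivial (CechCohomology x (A ⧸ P.asIdeal) d) := by
  induction d using Nat.strong_induction_on generalizing P with
  | _ d ih =>
  match d with
  | 0 =>
    have hmax := PrimeSpectrum.isMax_iff.1 (Order.coheight_eq_zero.1 hP)
    exact nontrivial_cechCohomology_zero x fun j =>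
      smul_quotient_eq_zero ((hx P le_rfl).2 hmax j)
  | d + 1 =>
    obtain ⟨-, ⟨Q₁, hPQ₁, hQ₁⟩, -⟩ := Order.coheight_eq_coe_add_one_iff.1
      (hP.trans (Nat.cast_succ d))
    have hquot (Q) (hPQ : P < Q) (hQ : Order.coheight Q = d) :
        Nontrivial (CechCohomology x (A ⧸ Q.asIdeal) d) :=
      ih d d.lt_succ_self (fun Q' hQ' => hx Q' (hPQ.le.trans hQ')) hQ
    match d with
    | 0 =>
      have hne : ¬∀ j, x j ∈ P.asIdeal := fun h =>
        (PrimeSpectrum.isMax_iff.2 ((hx P le_rfl).1 h)).not_lt hPQ₁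
      obtain ⟨j, hj⟩ := not_forall.1 hne
      have := hquot Q₁ hPQ₁ hQ₁
      exact nontrivial_cechCohomology_quotient_one x hPQ₁ hP.le hj
    | e + 1 =>
      have := isArtinian_cechCohomology_quotient x (i := e + 1) fun Q hQ => (hx Q hQ).1
      refine nontrivial_cechCohomology_quotient_succ_of_isArtinian x hP.le fun J hJ => ?_
      obtain ⟨Q, hPQ, hQ, hJQ⟩ := exists_gt_coheight_eq_not_le hP hJ
      exact ⟨Q, hPQ, hJQ, hQ.le, hquot Q hPQ hQ⟩

end Nonvanishing

section SupportDim

variable {A : Type*} [CommRing A] {N : Type*} [AddCommGroup N] [Module A N] {d l : ℕ}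

theorem coheight_le_of_supportDim_le (h : Module.supportDim A N ≤ d) {P : PrimeSpectrum A}
    (hP : P ∈ Module.support A N) : Order.coheight P ≤ d := by
  refine Order.coheight_le fun p hp => ?_
  let c : LTSeries (Module.support A N) :=
    { length := p.length
      toFun := fun i => ⟨p i, Module.mem_support_mono
        (show P ≤ p i from hp ▸ LTSeries.head_le p i) hP⟩
      step := fun i => p.step i }
  exact_mod_cast (Order.LTSeries.length_le_krullDim c).trans h

theorem exists_mem_support_coheight_eq (h : Module.supportDim A N = d) :
    ∃ P ∈ Module.support A N, Order.coheight P = d := by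
  obtain ⟨c, hc⟩ := Order.le_krullDim_iff.1 h.ge
  refine ⟨c.head.1, c.head.2, le_antisymm (coheight_le_of_supportDim_le h.le c.head.2) ?_⟩
  rw [← hc]
  exact Order.length_le_coheight_head (p := c.map Subtype.val fun _ _ h => h)

theorem supportDim_le_of_forall_mem_iff_isMaximal [IsNoetherianRing A] [Module.Finite A N]
    {y : Fin l → A}
    (hy : ∀ Q ∈ Module.support A N, (∀ j, y j ∈ Q.asIdeal) ↔ Q.asIdeal.IsMaximal) :
    Module.supportDim A N ≤ l := by
  induction l generalizing N with
  | zero =>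
    refine Order.krullDim_nonpos_iff_forall_isMax.2 fun Q Q' hQ' => ?_
    exact PrimeSpectrum.isMax_iff.2 ((hy Q.1 Q.2).1 fun j => j.elim0) hQ'
  | succ l ih =>
    have hjac : y 0 ∈ (Module.annihilator A N).jacobson := Ideal.mem_sInf.2 fun {m} hm =>
      (hy ⟨m, hm.2.isPrime⟩ (Module.mem_support_iff_of_finite.2 hm.1)).2 hm.2 0
    have hquot : Module.supportDim A (QuotSMulTop (y 0) N) ≤ l := by
      refine ih (y := Fin.tail y) fun Q hQ => ?_
      rw [Module.support_quotSMulTop] at hQ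
      rw [← hy Q hQ.1, Fin.forall_fin_succ]
      exact ⟨fun h => ⟨hQ.2 rfl, h⟩, And.right⟩
    rw [Nat.cast_succ]
    exact (Module.supportDim_le_supportDim_quotSMulTop_succ_of_mem_jacobson hjac).trans
      (add_le_add_left hquot 1)

end SupportDim

section NonvanishingModule

variable {A : Type u} [CommRing A]

open Pointwise in
theorem lt_of_mem_support_quotient_of_ne_bot {P Q : PrimeSpectrum A}
    {K : Submodule A (A ⧸ P.asIdeal)} (hK : K ≠ ⊥)
    (hQ : Q ∈ Module.support A ((A ⧸ P.asIdeal) ⧸ K)) : P < Q := by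
  obtain ⟨a, haK, ha⟩ := K.exists_mem_ne_zero_of_ne_bot hK
  obtain ⟨a, rfl⟩ := Ideal.Quotient.mk_surjective a
  have hle : a • (⊤ : Submodule A (A ⧸ P.asIdeal)) ≤ K := by
    rintro _ ⟨b, -, rfl⟩
    obtain ⟨b, rfl⟩ := Ideal.Quotient.mk_surjective b
    exact (congrArg (Ideal.Quotient.mk P.asIdeal) (mul_comm b a)) ▸ K.smul_mem b haK
  exact lt_of_mem_support_quotSMulTop_quotient (mt Ideal.Quotient.eq_zero_iff_mem.2 ha) <|
    Module.support_subset_of_surjective (Submodule.factor hle) (Submodule.factor_surjective hle) hQ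

variable [IsNoetherianRing A] {N : Type v} [AddCommGroup N] [Module A N] [Module.Finite A N]

theorem exists_linearMap_quotient_ne_zero {P : PrimeSpectrum A} (hP : P ∈ Module.support A N) :
    ∃ f : N →ₗ[A] A ⧸ P.asIdeal, f ≠ 0 := by
  by_contra! h
  obtain ⟨r, hr, hreg⟩ := IsSMulRegular.subsingleton_linearMap_iff.1 (subsingleton_of_forall_eq 0 h)
  have hrP := Module.mem_support_iff_of_finite.1 hP hr
  exact one_ne_zero (hreg ((smul_quotient_eq_zero hrP 1).trans (smul_zero r).symm))

theorem nontrivial_cechCohomology_of_supportDim_eq {l : ℕ} {y : Fin l → A} {d : ℕ}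
    (hy : ∀ Q ∈ Module.support A N, (∀ j, y j ∈ Q.asIdeal) ↔ Q.asIdeal.IsMaximal)
    (hd : Module.supportDim A N = d) : Nontrivial (CechCohomology y N d) := by
  obtain ⟨P, hP, hPd⟩ := exists_mem_support_coheight_eq hd
  obtain ⟨f, hf⟩ := exists_linearMap_quotient_ne_zero hP
  have hker : Subsingleton (CechCohomology y (LinearMap.ker f) (d + 1)) :=
    subsingleton_cechCohomology_of_coheight_lt y fun Q hQ =>
      (coheight_le_of_supportDim_le hd.le (Module.support_subset_of_injective _
        (Submodule.subtype_injective _) hQ)).trans_lt (Nat.cast_lt.2 d.lt_succ_self)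
  have hcoker : Subsingleton (CechCohomology y ((A ⧸ P.asIdeal) ⧸ LinearMap.range f) d) :=
    subsingleton_cechCohomology_of_coheight_lt y fun Q hQ =>
      Order.coheight_le_coe_iff.1 hPd.le Q
        (lt_of_mem_support_quotient_of_ne_bot (mt LinearMap.range_eq_bot.1 hf) hQ)
  have := nontrivial_cechCohomology_quotient_prime y
    (fun Q hQ => hy Q (Module.mem_support_mono hQ hP)) hPd
  exact (cechCohomologyMap_surjective_of_ker_of_range y f d).nontrivial

end NonvanishingModule

section Height

variable {R : Type u} [CommRing R] {M : Type v} [AddCommGroup M] [Module R M]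
  {l : ℕ} {x : Fin l → R}

theorem annihilator_le_annihilator_localizedModule (S : Submonoid R) :
    Module.annihilator R M ≤ Module.annihilator R (LocalizedModule S M) := fun r hr => by
  refine Module.mem_annihilator.2 fun w => ?_
  induction w using LocalizedModule.induction_on with
  | h m s => rw [LocalizedModule.smul'_mk, Module.mem_annihilator.1 hr, LocalizedModule.zero_mk]

theorem forall_mem_iff_isMaximal_of_mem_minimalPrimes {q : Ideal R} [q.IsPrime]
    (hq : q ∈ (Module.annihilator R M ⊔ Ideal.span (Set.range x)).minimalPrimes)
    (Q : PrimeSpectrum (Localization.AtPrime q))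
    (hQ : Q ∈ Module.support (Localization.AtPrime q) (LocalizedModule q.primeCompl M)) :
    (∀ j, algebraMap R (Localization.AtPrime q) (x j) ∈ Q.asIdeal) ↔ Q.asIdeal.IsMaximal := by
  refine ⟨fun hx => ?_, fun hmax j => ?_⟩
  · have hcomap : Module.annihilator R M ⊔ Ideal.span (Set.range x) ≤
        Q.asIdeal.comap (algebraMap R _) := by
      refine sup_le ?_ (Ideal.span_le.2 (Set.range_subset_iff.2 hx))
      have hQR : Q.comap (algebraMap R _) ∈ Module.support R (LocalizedModule q.primeCompl M) :=
        Module.support_subset_preimage_comap (A := Localization.AtPrime q) hQ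
      exact (annihilator_le_annihilator_localizedModule _).trans
        (Module.annihilator_le_of_mem_support hQR)
    have hle : Q.asIdeal.comap (algebraMap R _) ≤ q :=
      (Ideal.comap_mono (IsLocalRing.le_maximalIdeal Q.isPrime.ne_top)).trans_eq
        Localization.AtPrime.under_maximalIdeal
    have hqQ : IsLocalRing.maximalIdeal (Localization.AtPrime q) ≤ Q.asIdeal := by
      rw [← Localization.AtPrime.map_eq_maximalIdeal, Ideal.map_le_iff_le_comap]
      exact hq.2 ⟨Q.isPrime.comap _, hcomap⟩ hle
    exact (IsLocalRing.maximalIdeal.isMaximal _).eq_of_le Q.isPrime.ne_top hqQ ▸ inferInstance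
  · rw [IsLocalRing.eq_maximalIdeal hmax, IsLocalization.AtPrime.to_map_mem_maximal_iff _ q]
    exact hq.1.2 (Ideal.mem_sup_right (Ideal.subset_span ⟨j, rfl⟩))

variable [Module.Finite R M]

theorem exists_le_mem_minimalPrimes {I : Ideal R} {p : PrimeSpectrum R}
    (hp : p ∈ Module.support R M ∩ PrimeSpectrum.zeroLocus (I : Set R)) :
    ∃ q ≤ p, q ∈ Module.support R M ∩ PrimeSpectrum.zeroLocus (I : Set R) ∧
      q.asIdeal ∈ (Module.annihilator R M ⊔ I).minimalPrimes := by
  obtain ⟨q, hq, hqp⟩ := Ideal.exists_minimalPrimes_le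
    (sup_le (Module.annihilator_le_of_mem_support hp.1) hp.2)
  exact ⟨⟨q, hq.1.1⟩, hqp, ⟨Module.mem_support_iff_of_finite.2 (le_sup_left.trans hq.1.2),
    le_sup_right.trans hq.1.2⟩, hq⟩

theorem heightOn_eq_top_of_smul_eq_top {I : Ideal R} (h : I • (⊤ : Submodule R M) = ⊤) :
    heightOn M I = ⊤ := by
  have hempty : Module.support R M ∩ PrimeSpectrum.zeroLocus (I : Set R) = ∅ := by
    rwa [← Module.support_quotient, Module.support_eq_empty_iff,
      Submodule.Quotient.subsingleton_iff]
  simp only [heightOn, hempty, Set.mem_empty_iff_false, iInf_false, iInf_top]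

theorem le_heightOn_of_forall_nontrivial (h : ∀ p ∈ Module.support R
      (M ⧸ Ideal.span (Set.range x) • (⊤ : Submodule R M)),
      Nontrivial (LocalizedModule p.asIdeal.primeCompl (CechCohomology x M l))) :
    (l : WithBot ℕ∞) ≤ heightOn M (Ideal.span (Set.range x)) := by
  refine le_iInf₂ fun p hp => ?_
  by_contra! hlt
  have := h p (by rwa [Module.support_quotient])
  exact not_subsingleton _ <| (subsingleton_localized_cechCohomology_top_iff x M _).2 <|
    subsingleton_cechCohomology_top_of_supportDim_lt _ hlt

variable [IsNoetherianRing R]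

theorem primeHeightOn_le_of_mem_minimalPrimes {q : PrimeSpectrum R}
    (hq : q.asIdeal ∈ (Module.annihilator R M ⊔ Ideal.span (Set.range x)).minimalPrimes) :
    primeHeightOn M q ≤ l :=
  supportDim_le_of_forall_mem_iff_isMaximal (forall_mem_iff_isMaximal_of_mem_minimalPrimes hq)

theorem heightOn_le_of_smul_ne_top
    (hx : Ideal.span (Set.range x) • (⊤ : Submodule R M) ≠ ⊤) :
    heightOn M (Ideal.span (Set.range x)) ≤ l := by
  have := Submodule.Quotient.nontrivial_iff.2 hx
  obtain ⟨p, hp⟩ := Module.nonempty_support_of_nontrivial (R := R)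
    (M := M ⧸ Ideal.span (Set.range x) • (⊤ : Submodule R M))
  rw [Module.support_quotient] at hp
  obtain ⟨q, -, hq, hmin⟩ := exists_le_mem_minimalPrimes hp
  exact (iInf₂_le q hq).trans (primeHeightOn_le_of_mem_minimalPrimes hmin)

theorem nontrivial_localized_cechCohomology_top_of_le_heightOn
    (h : (l : WithBot ℕ∞) ≤ heightOn M (Ideal.span (Set.range x))) {p : PrimeSpectrum R}
    (hp : p ∈ Module.support R (M ⧸ Ideal.span (Set.range x) • (⊤ : Submodule R M))) :
    Nontrivial (LocalizedModule p.asIdeal.primeCompl (CechCohomology x M l)) := by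
  rw [Module.support_quotient] at hp
  obtain ⟨q, hqp, hq, hmin⟩ := exists_le_mem_minimalPrimes hp
  have hd : primeHeightOn M q = l :=
    (primeHeightOn_le_of_mem_minimalPrimes hmin).antisymm (h.trans (iInf₂_le q hq))
  have hq' : q ∈ Module.support R (CechCohomology x M l) := by
    rw [Module.mem_support_iff, ← not_subsingleton_iff_nontrivial,
      subsingleton_localized_cechCohomology_top_iff, not_subsingleton_iff_nontrivial]
    exact nontrivial_cechCohomology_of_supportDim_eq
      (forall_mem_iff_isMaximal_of_mem_minimalPrimes hmin) hd
  exact Module.mem_support_iff.1 (Module.mem_support_mono hqp hq')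

end Height

end ParamSeq

theorem mainTheorem6_general {R : Type*} [CommRing R] {M : Type*} [AddCommGroup M] [Module R M]
    [Module.Finite R M] {l : ℕ} (x : Fin l → R) :
    ((∀ p ∈ Module.support R (M ⧸ Ideal.span (Set.range x) • (⊤ : Submodule R M)),
        Nontrivial (LocalizedModule p.asIdeal.primeCompl (ParamSeq.CechCohomology x M l))) →
      (l : WithBot ℕ∞) ≤ ParamSeq.heightOn M (Ideal.span (Set.range x))) ∧
    (IsNoetherianRing R →
      (ParamSeq.IsParameterSequence x M ↔
        ParamSeq.heightOn M (Ideal.span (Set.range x)) = (l : WithBot ℕ∞))) := by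
  refine ⟨ParamSeq.le_heightOn_of_forall_nontrivial, fun _ => ⟨fun h => ?_, fun h =>
    ⟨ParamSeq.isWeaklyProregular_of_isNoetherianRing M x, fun htop => ?_, fun p => ?_⟩⟩⟩
  · exact (ParamSeq.heightOn_le_of_smul_ne_top h.smul_ne_top).antisymm
      (ParamSeq.le_heightOn_of_forall_nontrivial h.nontrivial_localization)
  · rw [ParamSeq.heightOn_eq_top_of_smul_eq_top htop] at h
    exact WithBot.coe_injective.ne (ENat.natCast_ne_top l) h.symm
  · exact ParamSeq.nontrivial_localized_cechCohomology_top_of_le_heightOn h.ge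

theorem mainTheorem6 {R : Type*} [CommRing R] {M : Type*} [AddCommGroup M] [Module R M]
    [Module.Finite R M] {l : ℕ} (x : Fin l → R) :
    (ParamSeq.IsParameterSequence x M →
      (l : WithBot ℕ∞) ≤ ParamSeq.heightOn M (Ideal.span (Set.range x))) ∧
    (IsNoetherianRing R →
      (ParamSeq.IsParameterSequence x M ↔
        ParamSeq.heightOn M (Ideal.span (Set.range x)) = (l : WithBot ℕ∞))) :=
  (mainTheorem6_general x).imp_left fun h hx => h hx.nontrivial_localization
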